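/- **Setting and conventions.** Let $n\ge 1$ and let $(M,g)$ be a smooth non-empty Riemannian manifold of dimension $4n+3$, with Levi-Civita connection $\nabla^g$. A Sasakian structure on $(M,g)$ is given by a smooth unit Killing vector field $\xi$ such that, with $\eta=g(\xi,\cdot)$ and $\varphi=-\nabla^g\xi$, one has $(\nabla^g_X\varphi)Y=g(X,Y)\xi-\eta(Y)X$ for all $X,Y$; put $\Phi(X,Y)=g(X,\varphi Y)$. Let $\{\xi_r,\eta_r,\varphi_r\}_{r=1,2,3}$ be a 3-Sasakian structure: three Sasakian structures with $g(\xi_r,\xi_s)=\delta_{rs}$ and $[\xi_r,\xi_{r+1}]=2\xi_{r+2}$. Indices $1,2,3$ are read modulo $3$. For 1-forms, $(\alpha\wedge\beta)(X,Y)=\alpha(X)\beta(Y)-\alpha(Y)\beta(X)$; for a 1-form $\alpha$ and a 2-form $\Omega$, $(\alpha\wedge\Omega)(X,Y,Z)=\alpha(X)\Omega(Y,Z)+\alpha(Y)\Omega(Z,X)+\alpha(Z)\Omega(X,Y)$. Define $(1,2)$-tensors $T^o$ and $T^{rs}$, $r,s\in\{1,2,3\}$, by $$g(T^o(X,Y),Z)=(\eta_1\wedge\eta_2\wedge\eta_3)(X,Y,Z),\qquad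 g(T^{rs}(X,Y),Z)=(\eta_r\wedge\Phi_s)(X,Y,Z).$$ For a $(1,2)$-tensor $T$ let $\operatorname{div}(T)(X,Y)=\sum_k g\big(e_k,(\nabla^g_{e_k}T)(X,Y)\big)$, and for a connection $\nabla$ let $\mathrm{Ric}^\nabla(X,Y)=\sum_k g\big(R^\nabla(e_k,X)Y,e_k\big)$, where $(e_k)$ is a local orthonormal frame and $R^\nabla(X,Y)Z=\nabla_X\nabla_YZ-\nabla_Y\nabla_XZ-\nabla_{[X,Y]}Z$. *The special unitary case.* Here suppose moreover that $M$ is the homogeneous 3-Sasakian manifold $\mathrm{SU}(n+2)/\mathrm{S}(\mathrm{U}(n)\times\mathrm{U}(1))$; that is, $\mathrm{SU}(n+2)$ acts smoothly and transitively on $M$ by isometries preserving $\xi_1,\xi_2,\xi_3$, and the isotropy group of a base point $o$ is the group of all matrices $\mathrm{diag}(a,K,a)\in\mathrm{SU}(n+2)$ (diagonal blocks of sizes $1,n,1$). Let $h=\big(1+\tfrac n2\big)^{-1}\mathrm{diag}\big(-\tfrac n2 i,\,i,\dots,i,\,-\tfrac n2 i\big)\in\mathfrak{su}(n+2)$, and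 let $\varphi_0$ be the $\mathrm{SU}(n+2)$-invariant smooth field of endomorphisms of $TM$ whose value at $o$ is $X^+_o\mapsto[h,X]^+_o$, where $X^+_o=\frac{d}{dt}\big|_{t=0}\exp(tX)\cdot o$ for $X\in\mathfrak{su}(n+2)$. Put $\Phi_0(X,Y)=g(X,\varphi_0Y)$ and $g(T^{r0}(X,Y),Z)=(\eta_r\wedge\Phi_0)(X,Y,Z)$, $r=1,2,3$. **Statement.** 1. $\operatorname{div}(T^o)=0$, and for $r\in\{1,2,3\}$ $$\operatorname{div}(T^{rs})=\begin{cases}0&\text{if } s=r,\\ 2\Phi_{r+2}+(4n+2)\,\eta_r\wedge\eta_{r+1}&\text{if } s=r+1,\\ -2\Phi_{r+1}+(4n+2)\,\eta_r\wedge\eta_{r+2}&\text{if } s=r+2.\end{cases}$$ In the special unitary case, also $\operatorname{div}(T^{r0})=0$ for $r=1,2,3$. 2. Let $a\in\mathbb R$ and let $B=(b_{rs})$ be a real $3\times3$ matrix. Let $T=aT^o+\sum_{r,s=1}^3b_{rs}T^{rs}$ or, in the special unitary case and for any $c\in\mathbb R^3$, $T=aT^o+\sum_{r,s=1}^3b_{rs}T^{rs}+\sum_{r=1}^3c_rT^{r0}$.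 Then $\operatorname{div}(T)=0$ if and only if $B$ is a symmetric matrix. 3. For $T$ as in 2, the connection $\nabla=\nabla^g+T$ has symmetric Ricci tensor if and only if $B$ is a symmetric matrix. The same holds for $\nabla=\nabla^g+\tfrac12T$, the metric connection whose torsion is $T$. -/

import Mathlib

open scoped InnerProductSpace

noncomputable section

/-! ### Multilinear algebra on a Euclidean vector space -/

section Algebra

variable {V : Type*} [NormedAddCommGroup V] [InnerProductSpace ℝ V]

/-- The wedge product of two `1`-forms: `(α ∧ β)(X, Y) = α(X) β(Y) - α(Y) β(X)`. -/
def wedge₁₁ (α β : V →ₗ[ℝ] ℝ) : V →ₗ[ℝ] V →ₗ[ℝ] ℝ :=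
  α.smulRight β - β.smulRight α

/-- The wedge product of a `1`-form and a `2`-form:
`(α ∧ Ω)(X, Y, Z) = α(X) Ω(Y, Z) + α(Y) Ω(Z, X) + α(Z) Ω(X, Y)`. -/
def wedge₁₂ (α : V →ₗ[ℝ] ℝ) (Ω : V →ₗ[ℝ] V →ₗ[ℝ] ℝ) : V →ₗ[ℝ] V →ₗ[ℝ] V →ₗ[ℝ] ℝ :=
  α.smulRight Ω + (LinearMap.smulRightₗ α).comp Ω.flip + (LinearMap.smulRightₗ.flip α).comp Ω

theorem wedge₁₁_apply (α β : V →ₗ[ℝ] ℝ) (X Y : V) :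
    wedge₁₁ α β X Y = α X * β Y - α Y * β X := by
  simp [wedge₁₁, mul_comm]

theorem wedge₁₂_apply (α : V →ₗ[ℝ] ℝ) (Ω : V →ₗ[ℝ] V →ₗ[ℝ] ℝ) (X Y Z : V) :
    wedge₁₂ α Ω X Y Z = α X * Ω Y Z + α Y * Ω Z X + α Z * Ω X Y := by
  simp [wedge₁₂, mul_comm]

/-- The bilinear form `(X, Y) ↦ g(X, φ Y)` of an endomorphism `φ`. -/
def endoForm (φ : V →ₗ[ℝ] V) : V →ₗ[ℝ] V →ₗ[ℝ] ℝ :=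
  (innerₗ V).compl₂ φ

theorem endoForm_apply (φ : V →ₗ[ℝ] V) (X Y : V) : endoForm φ X Y = ⟪X, φ Y⟫_ℝ := rfl

/-- Raising the last index of a trilinear form `θ` on a Euclidean vector space: the bilinear map
`T` determined by `g(T(X, Y), Z) = θ(X, Y, Z)`. -/
def raiseLast [FiniteDimensional ℝ V] (θ : V →ₗ[ℝ] V →ₗ[ℝ] V →ₗ[ℝ] ℝ) : V →ₗ[ℝ] V →ₗ[ℝ] V :=
  letI : CompleteSpace V := FiniteDimensional.complete ℝ V
  θ.compr₂
    { toFun := fun l => (InnerProductSpace.toDual ℝ V).symm l.toContinuousLinearMap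
      map_add' := fun l l' => by simp
      map_smul' := fun c l => by simp }

theorem inner_raiseLast [FiniteDimensional ℝ V] (θ : V →ₗ[ℝ] V →ₗ[ℝ] V →ₗ[ℝ] ℝ) (X Y Z : V) :
    ⟪raiseLast θ X Y, Z⟫_ℝ = θ X Y Z := by
  simp [raiseLast]

end Algebra

open Bundle
open scoped Manifold ContDiff

/-! ### Connections on a Riemannian manifold -/

section Geometry

variable {E : Type*} [NormedAddCommGroup E] [NormedSpace ℝ E] [FiniteDimensional ℝ E]
  {H : Type*} [TopologicalSpace H] {I : ModelWithCorners ℝ E H}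
  {M : Type*} [TopologicalSpace M] [ChartedSpace H M]

instance tangentSpace_finiteDimensional (x : M) : FiniteDimensional ℝ (TangentSpace I x) :=
  inferInstanceAs (FiniteDimensional ℝ E)

/-- `∇` is the Levi-Civita connection of the Riemannian metric: a smooth connection that is
compatible with the metric and has vanishing torsion. -/
structure IsLeviCivita [IsManifold I ∞ M]
    [RiemannianBundle (fun x : M => TangentSpace I x)]
    [IsContMDiffRiemannianBundle I ∞ E (fun x : M => TangentSpace I x)]
    (cov : CovariantDerivative I E (TangentSpace I : M → Type _)) : Prop where
  smooth : cov.ContMDiffCovariantDerivative ∞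
  metric : ∀ (Y Z : Π x : M, TangentSpace I x) (x : M) (u : TangentSpace I x),
    MDiffAt (T% Y) x → MDiffAt (T% Z) x →
      d% (fun y => ⟪Y y, Z y⟫_ℝ) x u = ⟪cov Y x u, Z x⟫_ℝ + ⟪Y x, cov Z x u⟫_ℝ
  torsionFree : cov.torsion = 0

/-- The curvature `R(X, Y) Z = ∇_X ∇_Y Z - ∇_Y ∇_X Z - ∇_[X,Y] Z` at the point `p`, for vector
fields `X`, `Y`, `Z`. -/
def curvatureAt [IsManifold I ∞ M] (cov : CovariantDerivative I E (TangentSpace I : M → Type _))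
    (X Y Z : Π x : M, TangentSpace I x) (p : M) : TangentSpace I p :=
  cov (fun q => cov Z q (Y q)) p (X p) - cov (fun q => cov Z q (X q)) p (Y p)
    - cov Z p (VectorField.mlieBracket I X Y p)

variable [IsManifold I ∞ M] [RiemannianBundle (fun x : M => TangentSpace I x)]

/-- The Ricci tensor `Ric(u, v) = ∑ᵢ g(R(eᵢ, u) v, eᵢ)` of a connection, for an orthonormal basis
`e` of the tangent space at `p`. Tangent vectors are extended to local smooth vector fields. -/
def ricci (cov : CovariantDerivative I E (TangentSpace I : M → Type _)) (p : M)
    (u v : TangentSpace I p) : ℝ :=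
  ∑ i, ⟪curvatureAt cov (FiberBundle.extend E (stdOrthonormalBasis ℝ (TangentSpace I p) i))
      (FiberBundle.extend E u) (FiberBundle.extend E v) p,
    stdOrthonormalBasis ℝ (TangentSpace I p) i⟫_ℝ

/-- The Ricci tensor is symmetric. -/
def HasSymmetricRicci (cov : CovariantDerivative I E (TangentSpace I : M → Type _)) : Prop :=
  ∀ (p : M) (u v : TangentSpace I p), ricci cov p u v = ricci cov p v u

/-- The covariant derivative `(∇_w T)(u, v) = ∇_w (T(U, V)) - T(∇_w U, v) - T(u, ∇_w V)` of a
`(1,2)`-tensor, where `U`, `V` are local smooth vector fields that extend `u`, `v`. -/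
def covDerivTensor (cov : CovariantDerivative I E (TangentSpace I : M → Type _))
    (T : Π x : M, TangentSpace I x →ₗ[ℝ] TangentSpace I x →ₗ[ℝ] TangentSpace I x) (p : M)
    (w u v : TangentSpace I p) : TangentSpace I p :=
  cov (fun q => T q (FiberBundle.extend E u q) (FiberBundle.extend E v q)) p w
    - T p (cov (FiberBundle.extend E u) p w) v - T p u (cov (FiberBundle.extend E v) p w)

/-- The divergence `div(T)(u, v) = ∑ᵢ g(eᵢ, (∇_{eᵢ} T)(u, v))` of a `(1,2)`-tensor, for an
orthonormal basis `e` of the tangent space at `p`. -/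
def divergence (cov : CovariantDerivative I E (TangentSpace I : M → Type _))
    (T : Π x : M, TangentSpace I x →ₗ[ℝ] TangentSpace I x →ₗ[ℝ] TangentSpace I x) (p : M)
    (u v : TangentSpace I p) : ℝ :=
  ∑ i, ⟪stdOrthonormalBasis ℝ (TangentSpace I p) i,
    covDerivTensor cov T p (stdOrthonormalBasis ℝ (TangentSpace I p) i) u v⟫_ℝ

/-- The connection `∇ + T`, that is, `(X, Y) ↦ ∇_X Y + T(X, Y)`. -/
def addTensor (cov : CovariantDerivative I E (TangentSpace I : M → Type _))
    (T : Π x : M, TangentSpace I x →ₗ[ℝ] TangentSpace I x →ₗ[ℝ] TangentSpace I x) :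
    CovariantDerivative I E (TangentSpace I : M → Type _) :=
  cov.addOneForm fun x => (T x).flip.toContinuousBilinearMap

theorem addTensor_apply (cov : CovariantDerivative I E (TangentSpace I : M → Type _))
    (T : Π x : M, TangentSpace I x →ₗ[ℝ] TangentSpace I x →ₗ[ℝ] TangentSpace I x)
    (X Y : Π x : M, TangentSpace I x) (p : M) :
    addTensor cov T Y p (X p) = cov Y p (X p) + T p (X p) (Y p) := rfl

/-! ### Sasakian and 3-Sasakian structures -/

/-- The endomorphism field `φ X = -∇_X ξ`. -/
def phiOf (cov : CovariantDerivative I E (TangentSpace I : M → Type _))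
    (ξ : Π x : M, TangentSpace I x) (x : M) : TangentSpace I x →L[ℝ] TangentSpace I x :=
  -cov ξ x

/-- The `1`-form `η` metrically equivalent to `ξ`. -/
def etaOf (ξ : Π x : M, TangentSpace I x) (x : M) : TangentSpace I x →ₗ[ℝ] ℝ :=
  innerₗ (TangentSpace I x) (ξ x)

/-- The fundamental form `Φ(X, Y) = g(X, φ Y)`. -/
def PhiOf (cov : CovariantDerivative I E (TangentSpace I : M → Type _))
    (ξ : Π x : M, TangentSpace I x) (x : M) : TangentSpace I x →ₗ[ℝ] TangentSpace I x →ₗ[ℝ] ℝ :=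
  endoForm (phiOf cov ξ x : TangentSpace I x →ₗ[ℝ] TangentSpace I x)

/-- The vector field `ξ`, together with `η = g(ξ, ·)` and `φ = -∇ξ`, is a Sasakian structure
(`cov` is the Levi-Civita connection): `ξ` is a smooth unit Killing vector field and
`(∇_X φ) Y = g(X, Y) ξ - η(Y) X`. -/
structure IsSasakian (cov : CovariantDerivative I E (TangentSpace I : M → Type _))
    (ξ : Π x : M, TangentSpace I x) : Prop where
  smooth : CMDiff ∞ (T% ξ)
  unit : ∀ x, ⟪ξ x, ξ x⟫_ℝ = 1
  killing : ∀ (x : M) (u v : TangentSpace I x), ⟪cov ξ x u, v⟫_ℝ + ⟪u, cov ξ x v⟫_ℝ = 0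
  nabla_phi : ∀ (X Y : Π x : M, TangentSpace I x) (x : M), MDiffAt (T% X) x → MDiffAt (T% Y) x →
    cov (fun y => phiOf cov ξ y (Y y)) x (X x) - phiOf cov ξ x (cov Y x (X x))
      = ⟪X x, Y x⟫_ℝ • ξ x - etaOf ξ x (Y x) • X x

/-- The vector fields `ξ 0`, `ξ 1`, `ξ 2` form a 3-Sasakian structure: they are orthonormal Reeb
fields of Sasakian structures and `[ξ r, ξ (r+1)] = 2 ξ (r+2)`, with indices modulo 3. -/
structure IsThreeSasakian (cov : CovariantDerivative I E (TangentSpace I : M → Type _))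
    (ξ : Fin 3 → Π x : M, TangentSpace I x) : Prop where
  sasakian : ∀ r, IsSasakian cov (ξ r)
  orthonormal : ∀ x, Orthonormal ℝ fun r => ξ r x
  bracket : ∀ (r : Fin 3) (x : M),
    VectorField.mlieBracket I (ξ r) (ξ (r + 1)) x = (2 : ℝ) • ξ (r + 2) x

/-! ### The torsion tensors -/

/-- The tensor `T^o`, metrically equivalent to `η₁ ∧ η₂ ∧ η₃`. -/
def torsionO (ξ : Fin 3 → Π x : M, TangentSpace I x) (x : M) :
    TangentSpace I x →ₗ[ℝ] TangentSpace I x →ₗ[ℝ] TangentSpace I x :=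
  raiseLast (wedge₁₂ (etaOf (ξ 0) x) (wedge₁₁ (etaOf (ξ 1) x) (etaOf (ξ 2) x)))

/-- The tensor metrically equivalent to `η ∧ Φ`, where `η = g(ξ, ·)` and `Φ(X, Y) = g(X, φ Y)`. -/
def torsionOf (ξ : Π x : M, TangentSpace I x)
    (φ : Π x : M, TangentSpace I x →L[ℝ] TangentSpace I x) (x : M) :
    TangentSpace I x →ₗ[ℝ] TangentSpace I x →ₗ[ℝ] TangentSpace I x :=
  raiseLast (wedge₁₂ (etaOf ξ x) (endoForm (φ x : TangentSpace I x →ₗ[ℝ] TangentSpace I x)))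

/-- The tensor `T^{rs}`, metrically equivalent to `η_r ∧ Φ_s`, for `r` and `s` among the three
Sasakian indices. -/
def torsionRS (cov : CovariantDerivative I E (TangentSpace I : M → Type _))
    (ξ : Fin 3 → Π x : M, TangentSpace I x) (r s : Fin 3) (x : M) :
    TangentSpace I x →ₗ[ℝ] TangentSpace I x →ₗ[ℝ] TangentSpace I x :=
  torsionOf (ξ r) (phiOf cov (ξ s)) x

/-- The tensor `a T^o + ∑ b_{rs} T^{rs}`. -/
def torsionAB (cov : CovariantDerivative I E (TangentSpace I : M → Type _))
    (ξ : Fin 3 → Π x : M, TangentSpace I x) (a : ℝ) (B : Matrix (Fin 3) (Fin 3) ℝ) (x : M) :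
    TangentSpace I x →ₗ[ℝ] TangentSpace I x →ₗ[ℝ] TangentSpace I x :=
  a • torsionO ξ x + ∑ r, ∑ s, B r s • torsionRS cov ξ r s x

/-- The tensor `a T^o + ∑ b_{rs} T^{rs} + ∑ c_r T^{r0}`, where `T^{r0}` is metrically equivalent
to `η_r ∧ Φ₀` with `Φ₀(X, Y) = g(X, φ₀ Y)`. -/
def torsionABC (cov : CovariantDerivative I E (TangentSpace I : M → Type _))
    (ξ : Fin 3 → Π x : M, TangentSpace I x)
    (φ₀ : Π x : M, TangentSpace I x →L[ℝ] TangentSpace I x)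
    (a : ℝ) (B : Matrix (Fin 3) (Fin 3) ℝ) (c : Fin 3 → ℝ) (x : M) :
    TangentSpace I x →ₗ[ℝ] TangentSpace I x →ₗ[ℝ] TangentSpace I x :=
  torsionAB cov ξ a B x + ∑ r, c r • torsionOf (ξ r) φ₀ x

/-- The tensor `T` has zero divergence. -/
def HasZeroDivergence (cov : CovariantDerivative I E (TangentSpace I : M → Type _))
    (T : Π x : M, TangentSpace I x →ₗ[ℝ] TangentSpace I x →ₗ[ℝ] TangentSpace I x) : Prop :=
  ∀ (p : M) (u v : TangentSpace I p), divergence cov T p u v = 0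

end Geometry

/-! ### The special unitary group and the homogeneous spaces on which it acts -/

section SpecialUnitary

open Matrix

/-- The real vector space `𝔰𝔲(m)` of traceless skew-Hermitian matrices. -/
def su (m : ℕ) : Submodule ℝ (Matrix (Fin m) (Fin m) ℂ) where
  carrier := {A | Aᴴ = -A ∧ A.trace = 0}
  zero_mem' := by simp
  add_mem' := by
    rintro A B ⟨hA, hA'⟩ ⟨hB, hB'⟩
    exact ⟨by rw [conjTranspose_add, hA, hB, neg_add, add_comm],
      by rw [trace_add, hA', hB', add_zero]⟩
  smul_mem' := by
    rintro c A ⟨hA, hA'⟩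
    exact ⟨by rw [conjTranspose_smul, hA, star_trivial, smul_neg],
      by rw [trace_smul, hA', smul_zero]⟩

/-- The Lie bracket `[X, Y] = XY - YX` of `𝔰𝔲(m)`. -/
def suBracket {m : ℕ} (X Y : su m) : su m :=
  ⟨(X : Matrix (Fin m) (Fin m) ℂ) * Y - (Y : Matrix (Fin m) (Fin m) ℂ) * X, by
    have hX := X.2.1
    have hY := Y.2.1
    refine ⟨?_, ?_⟩
    · rw [conjTranspose_sub, conjTranspose_mul, conjTranspose_mul, hX, hY]
      simp
    · rw [trace_sub, trace_mul_comm, sub_self]⟩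

theorem exp_mem_specialUnitaryGroup {m : ℕ} {A : Matrix (Fin m) (Fin m) ℂ} (hA : Aᴴ = -A)
    (hA' : A.trace = 0) : NormedSpace.exp A ∈ specialUnitaryGroup (Fin m) ℂ := by
  have hH : (Complex.I • A).IsHermitian := by
    simp [Matrix.IsHermitian, conjTranspose_smul, hA]
  set U := hH.eigenvectorUnitary
  set d : Fin m → ℂ := fun i => -Complex.I * (hH.eigenvalues i : ℂ) with hd
  have hUu : IsUnit (U : Matrix (Fin m) (Fin m) ℂ) :=
    ⟨Unitary.toUnits U, rfl⟩
  have hdet : IsUnit (U : Matrix (Fin m) (Fin m) ℂ).det := (isUnit_iff_isUnit_det _).1 hUu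
  have hinv : (U : Matrix (Fin m) (Fin m) ℂ)⁻¹ = star (U : Matrix (Fin m) (Fin m) ℂ) :=
    inv_eq_left_inv (Unitary.coe_star_mul_self U)
  have hAd : A = (U : Matrix (Fin m) (Fin m) ℂ) * diagonal d * (U : Matrix _ _ ℂ)⁻¹ := by
    have h := hH.spectral_theorem
    rw [Unitary.conjStarAlgAut_apply] at h
    have h2 : A = (-Complex.I) • (Complex.I • A) := by simp [smul_smul]
    rw [h2, h, hinv]
    have : diagonal d = (-Complex.I) • diagonal (RCLike.ofReal ∘ hH.eigenvalues) := by
      rw [← diagonal_smul]; rfl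
    rw [this]
    simp [U]
  have hsum : ∑ i, d i = 0 := by
    have : A.trace = ∑ i, d i := by
      rw [hAd, trace_mul_comm, ← mul_assoc, nonsing_inv_mul _ hdet, one_mul, trace_diagonal]
    rw [← this, hA']
  refine mem_specialUnitaryGroup_iff.2 ⟨?_, ?_⟩
  · rw [mem_unitaryGroup_iff, star_eq_conjTranspose, ← exp_conjTranspose, hA,
      ← exp_add_of_commute _ _ (Commute.refl A).neg_right, add_neg_cancel, NormedSpace.exp_zero]
  · rw [hAd, exp_conj _ _ hUu, det_mul, det_mul, mul_right_comm, ← det_mul, mul_nonsing_inv _ hdet,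
      det_one, one_mul, exp_diagonal, det_diagonal]
    simp [Pi.coe_exp, ← Complex.exp_eq_exp_ℂ, ← Complex.exp_sum, hsum]

/-- The exponential map `𝔰𝔲(m) → SU(m)`. -/
def expSU {m : ℕ} (A : su m) : specialUnitaryGroup (Fin m) ℂ :=
  ⟨NormedSpace.exp (A : Matrix (Fin m) (Fin m) ℂ), exp_mem_specialUnitaryGroup A.2.1 A.2.2⟩

/-- The diagonal entries of the element `h`. -/
def hEntry (n : ℕ) (i : Fin (n + 2)) : ℂ :=
  (1 + (n : ℂ) / 2)⁻¹ *
    (if i = 0 ∨ i = Fin.last (n + 1) then -((n : ℂ) / 2 * Complex.I) else Complex.I)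

/-- The element `h = (1 + n/2)⁻¹ diag(-n i/2, i, …, i, -n i/2)` of `𝔰𝔲(n + 2)`. -/
def hElt (n : ℕ) : su (n + 2) :=
  ⟨diagonal (hEntry n), by
    refine ⟨?_, ?_⟩
    · rw [diagonal_conjTranspose, diagonal_neg]
      congr 1
      ext i
      simp only [hEntry, Pi.star_apply]
      split_ifs <;> simp
    · have h : ∀ i : Fin n, (i.castSucc.succ : Fin (n + 2)) ≠ Fin.last (n + 1) := fun i => by
        simp [Fin.ext_iff, i.2.ne]
      rw [trace_diagonal, Fin.sum_univ_succ, Fin.sum_univ_castSucc]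
      simp [hEntry, h, Fin.succ_ne_zero]
      ring⟩

/-- The matrix is block diagonal of the form `diag(a, K, a)` with blocks of size `1`, `n`, `1`. -/
def IsIsotropyMatrix (n : ℕ) (K : Matrix (Fin (n + 2)) (Fin (n + 2)) ℂ) : Prop :=
  K 0 0 = K (Fin.last (n + 1)) (Fin.last (n + 1)) ∧
    (∀ j, j ≠ 0 → K 0 j = 0 ∧ K j 0 = 0) ∧
    ∀ j, j ≠ Fin.last (n + 1) → K (Fin.last (n + 1)) j = 0 ∧ K j (Fin.last (n + 1)) = 0

variable {E : Type*} [NormedAddCommGroup E] [NormedSpace ℝ E] [FiniteDimensional ℝ E]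
  {H : Type*} [TopologicalSpace H] (I : ModelWithCorners ℝ E H)
  {M : Type*} [TopologicalSpace M] [ChartedSpace H M]

/-- The transformation of `M` defined by `σ ∈ SU(m)`. -/
def actBy {M : Type*} {m : ℕ} [MulAction (specialUnitaryGroup (Fin m) ℂ) M]
    (σ : specialUnitaryGroup (Fin m) ℂ) (p : M) : M :=
  σ • p

/-- The value at `p` of the fundamental vector field of `X ∈ 𝔰𝔲(m)`: the velocity at `t = 0` of
the curve `t ↦ exp(tX) • p`. -/
def fundamentalVec {m : ℕ} [MulAction (specialUnitaryGroup (Fin m) ℂ) M] (X : su m) (p : M) :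
    TangentSpace I p :=
  (mfderiv 𝓘(ℝ, ℝ) I (fun t : ℝ => actBy (expSU (t • X)) p) 0 (1 : ℝ) : E)

variable [IsManifold I ∞ M] [RiemannianBundle (fun x : M => TangentSpace I x)]

/-- The action of `SU(n + 2)` on `M` is smooth and transitive, preserves the metric and the vector
fields `ξ r`, and the stabilizer of the base point `o` consists of the matrices `diag(a, K, a)`;
thus `M = SU(n + 2) / S(U(n) × U(1))` as a homogeneous manifold with structure fields `ξ r`.
Smoothness of `SU(n + 2) × M → M` is expressed by smooth maps into `SU(n + 2)`. -/
structure IsSUHomogeneous (n : ℕ) [MulAction (specialUnitaryGroup (Fin (n + 2)) ℂ) M]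
    (ξ : Fin 3 → Π x : M, TangentSpace I x) (o : M) : Prop where
  smooth : ∀ (k : ℕ) (f : EuclideanSpace ℝ (Fin k) → specialUnitaryGroup (Fin (n + 2)) ℂ),
    (∀ i j, ContDiff ℝ ∞ fun t => (f t : Matrix (Fin (n + 2)) (Fin (n + 2)) ℂ) i j) →
      ContMDiff (𝓘(ℝ, EuclideanSpace ℝ (Fin k)).prod I) I ∞
        fun q : EuclideanSpace ℝ (Fin k) × M => actBy (f q.1) q.2
  transitive : MulAction.IsPretransitive (specialUnitaryGroup (Fin (n + 2)) ℂ) M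
  stabilizer : ∀ σ : specialUnitaryGroup (Fin (n + 2)) ℂ,
    actBy σ o = o ↔ IsIsotropyMatrix n (σ : Matrix (Fin (n + 2)) (Fin (n + 2)) ℂ)
  isometric : ∀ (σ : specialUnitaryGroup (Fin (n + 2)) ℂ) (p : M) (u v : TangentSpace I p),
    ⟪mfderiv I I (actBy σ) p u, mfderiv I I (actBy σ) p v⟫_ℝ = ⟪u, v⟫_ℝ
  map_reeb : ∀ (σ : specialUnitaryGroup (Fin (n + 2)) ℂ) (r : Fin 3) (p : M),
    mfderiv I I (actBy σ) p (ξ r p) = ξ r (actBy σ p)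

/-- `φ₀` is the `SU(n + 2)`-invariant endomorphism field whose value at the base point `o`
corresponds to `ad h` under the identification of the tangent space at `o` with the quotient of
`𝔰𝔲(n + 2)` by the isotropy algebra. -/
structure IsPhiZero (n : ℕ) [MulAction (specialUnitaryGroup (Fin (n + 2)) ℂ) M] (o : M)
    (φ₀ : Π x : M, TangentSpace I x →L[ℝ] TangentSpace I x) : Prop where
  smooth : ContMDiff I (I.prod 𝓘(ℝ, E →L[ℝ] E)) ∞
    fun x : M => (TotalSpace.mk' (E →L[ℝ] E) x (φ₀ x) :
      TotalSpace (E →L[ℝ] E) fun x : M => TangentSpace I x →L[ℝ] TangentSpace I x)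
  invariant : ∀ (σ : specialUnitaryGroup (Fin (n + 2)) ℂ) (p : M) (u : TangentSpace I p),
    mfderiv I I (actBy σ) p (φ₀ p u)
      = φ₀ (actBy σ p) (mfderiv I I (actBy σ) p u)
  basePoint : ∀ X : su (n + 2),
    φ₀ o (fundamentalVec I X o) = fundamentalVec I (suBracket (hElt n) X) o

end SpecialUnitary

open VectorField
open scoped Topology

set_option linter.unusedSectionVars false

section SmoothFields

variable {E : Type*} [NormedAddCommGroup E] [NormedSpace ℝ E] [FiniteDimensional ℝ E]
  {H : Type*} [TopologicalSpace H] {I : ModelWithCorners ℝ E H}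
  {M : Type*} [TopologicalSpace M] [ChartedSpace H M] [IsManifold I ∞ M]

/-- The vector field `X` is smooth in a neighbourhood of `p`. -/
def SmoothNear (X : Π x : M, TangentSpace I x) (p : M) : Prop :=
  ∀ᶠ q in 𝓝 p, CMDiffAt ∞ (T% X) q

namespace SmoothNear

variable {X Y : Π x : M, TangentSpace I x} {p : M}

theorem contMDiffAt (h : SmoothNear X p) : CMDiffAt ∞ (T% X) p := h.self_of_nhds

theorem mdiffAt (h : SmoothNear X p) : MDiffAt (T% X) p :=
  h.contMDiffAt.mdifferentiableAt (by simp)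

theorem eventually (h : SmoothNear X p) : ∀ᶠ q in 𝓝 p, SmoothNear X q :=
  eventually_eventually_nhds.2 h

theorem eventually_mdiffAt (h : SmoothNear X p) : ∀ᶠ q in 𝓝 p, MDiffAt (T% X) q :=
  h.eventually.mono fun _ hq => hq.mdiffAt

theorem extend (v : TangentSpace I p) : SmoothNear (FiberBundle.extend E v) p := by
  obtain ⟨s, hs, hsσ⟩ := FiberBundle.exists_contMDiffOn_extend (k := ∞) I E v
  have := eventually_mem_nhds_iff.2 hs
  filter_upwards [this] with q hq
  exact (hsσ q (mem_of_mem_nhds hq)).contMDiffAt hq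

theorem sub (hX : SmoothNear X p) (hY : SmoothNear Y p) : SmoothNear (X - Y) p := by
  filter_upwards [hX, hY] with q h h' using h.sub_section h'

theorem smul {f : M → ℝ} (hf : ∀ᶠ q in 𝓝 p, CMDiffAt ∞ f q) (hX : SmoothNear X p) :
    SmoothNear (f • X) p := by
  filter_upwards [hf, hX] with q h h' using h.smul_section h'

end SmoothNear

namespace CovariantDerivative

variable [T2Space M] {cov : CovariantDerivative I E (TangentSpace I : M → Type _)}

theorem contMDiffAt_of_smoothNear (hcov : cov.ContMDiffCovariantDerivative ∞)
    {Y : Π x : M, TangentSpace I x} {p : M} (hY : SmoothNear Y p) :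
    ContMDiffAt I (I.prod 𝓘(ℝ, E →L[ℝ] E)) ∞
      (fun x : M => (TotalSpace.mk' (E →L[ℝ] E) x (cov Y x) :
        TotalSpace (E →L[ℝ] E) fun x : M => TangentSpace I x →L[ℝ] TangentSpace I x)) p := by
  obtain ⟨u, huY, hu, hpu⟩ := eventually_nhds_iff.1 hY
  obtain ⟨ψ, hψu⟩ : ∃ ψ : SmoothBumpFunction I p, tsupport ψ ⊆ u :=
    ((SmoothBumpFunction.nhds_basis_tsupport (I := I) p).mem_iff.1 (hu.mem_nhds hpu)).imp
      fun _ h => h.2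
  have hglob : CMDiff ∞ (T% ((ψ : M → ℝ) • Y)) :=
    ContMDiffOn.smul_section_of_tsupport (ψ.contMDiff.contMDiffOn) hu hψu
      fun q hq => (huY q hq).contMDiffWithinAt
  have h := hcov.contMDiff.contMDiff (σ := (ψ : M → ℝ) • Y) (by
    rw [contMDiffOn_univ]; exact hglob)
  rw [contMDiffOn_univ] at h
  refine (h p).congr_of_eventuallyEq ?_
  have h1 : ∀ᶠ q in 𝓝 p, ∀ᶠ x in 𝓝 q, ((ψ : M → ℝ) • Y) x = Y x :=
    eventually_eventually_nhds.2 (ψ.eventuallyEq_one.mono fun x hx => by simp [hx])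
  filter_upwards [h1, hY.eventually_mdiffAt] with q hq hqY
  have : cov ((ψ : M → ℝ) • Y) q = cov Y q :=
    cov.isCovariantDerivativeOnUniv.congr_of_eventuallyEq
      ((hglob q).mdifferentiableAt (by simp)) hqY Filter.univ_mem hq
  exact congrArg (TotalSpace.mk' (E →L[ℝ] E) q) this.symm

theorem add_apply (cov : CovariantDerivative I E (TangentSpace I : M → Type _))
    {X Y : Π x : M, TangentSpace I x} {p : M} (hX : MDiffAt (T% X) p) (hY : MDiffAt (T% Y) p)
    (w : TangentSpace I p) : cov (X + Y) p w = cov X p w + cov Y p w := by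
  rw [cov.isCovariantDerivativeOnUniv.add hX hY]
  rfl

theorem smul_apply (cov : CovariantDerivative I E (TangentSpace I : M → Type _)) (a : ℝ)
    {X : Π x : M, TangentSpace I x} {p : M} (hX : MDiffAt (T% X) p)
    (w : TangentSpace I p) : cov (a • X) p w = a • cov X p w := by
  rw [cov.isCovariantDerivativeOnUniv.smul_const a hX]
  rfl

theorem leibniz_apply (cov : CovariantDerivative I E (TangentSpace I : M → Type _))
    {f : M → ℝ} {X : Π x : M, TangentSpace I x} {p : M} (hf : MDiffAt f p)
    (hX : MDiffAt (T% X) p) (w : TangentSpace I p) :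
    cov (f • X) p w = f p • cov X p w + d% f p w • X p := by
  rw [cov.isCovariantDerivativeOnUniv.leibniz hX hf]
  rfl

theorem _root_.SmoothNear.covariantDeriv (hcov : cov.ContMDiffCovariantDerivative ∞)
    {X Y : Π x : M, TangentSpace I x} {p : M} (hX : SmoothNear X p) (hY : SmoothNear Y p) :
    SmoothNear (fun q => cov Y q (X q)) p := by
  filter_upwards [hX, hY.eventually] with q h h'
  exact (contMDiffAt_of_smoothNear hcov h').clm_bundle_apply h

end CovariantDerivative

theorem isManifold_minSmoothness (k : ℕ) : IsManifold I (minSmoothness ℝ k) M :=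
  .of_le (n := ∞) (by
    simp only [minSmoothness_of_isRCLikeNormedField]
    exact WithTop.coe_le_coe.2 le_top)

theorem SmoothNear.mlieBracket {X Y : Π x : M, TangentSpace I x} {p : M}
    (hX : SmoothNear X p) (hY : SmoothNear Y p) : SmoothNear (mlieBracket I X Y) p := by
  have : IsManifold I (((⊤ : ℕ∞) : WithTop ℕ∞) + 1) M := by
    rw [show ((⊤ : ℕ∞) : WithTop ℕ∞) + 1 = ∞ by rfl]
    infer_instance
  have : IsManifold I (minSmoothness ℝ 2) M := isManifold_minSmoothness 2
  have : IsManifold I (minSmoothness ℝ 3) M := isManifold_minSmoothness 3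
  filter_upwards [hX, hY] with q h h'
  exact ContMDiffAt.mlieBracket_vectorField (m := ⊤) (n := ⊤) h h' (by
    rw [minSmoothness_of_isRCLikeNormedField]; rfl)

/-- A vector field acts on functions as a derivation, and the Lie bracket is the commutator. -/
theorem mvfderiv_mlieBracket {X Y : Π x : M, TangentSpace I x} {p : M}
    (hX : SmoothNear X p) (hY : SmoothNear Y p) {f a b : M → ℝ}
    (hf : ∀ᶠ q in 𝓝 p, CMDiffAt ∞ f q) (ha : MDiffAt a p) (hb : MDiffAt b p)
    (hfa : ∀ᶠ q in 𝓝 p, d% f q (X q) = a q) (hfb : ∀ᶠ q in 𝓝 p, d% f q (Y q) = b q) :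
    d% f p (mlieBracket I X Y p) = d% b p (X p) - d% a p (Y p) := by
  by_cases hE : ∀ w : TangentSpace I p, w = 0
  · rw [hE (mlieBracket I X Y p), hE (X p), hE (Y p)]
    simp
  push Not at hE
  obtain ⟨w, hw⟩ := hE
  set W : Π x : M, TangentSpace I x := FiberBundle.extend E w with hWdef
  have hW : SmoothNear W p := SmoothNear.extend w
  have hWp : W p = w := by simp [hWdef]
  have hfd : ∀ᶠ q in 𝓝 p, MDiffAt f q := hf.mono fun q h => h.mdifferentiableAt (by simp)
  have h2 : (minSmoothness ℝ 2 : WithTop ℕ∞) ≤ ∞ := by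
    simp only [minSmoothness_of_isRCLikeNormedField]
    exact WithTop.coe_le_coe.2 le_top
  have h3 : IsManifold I (minSmoothness ℝ 3) M := isManifold_minSmoothness 3
  have key := leibniz_identity_mlieBracket_apply (hX.contMDiffAt.of_le h2)
    (hY.contMDiffAt.of_le h2) ((hW.smul hf).contMDiffAt.of_le h2)
  have key0 := leibniz_identity_mlieBracket_apply (hX.contMDiffAt.of_le h2)
    (hY.contMDiffAt.of_le h2) (hW.contMDiffAt.of_le h2)
  have eY : mlieBracket I Y (f • W) =ᶠ[𝓝 p] (b • W + f • mlieBracket I Y W) := by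
    filter_upwards [hfb, hfd, hW.eventually_mdiffAt] with q h1 h2 h3
    rw [mlieBracket_smul_right h2 h3, h1]
    rfl
  have eX : mlieBracket I X (f • W) =ᶠ[𝓝 p] (a • W + f • mlieBracket I X W) := by
    filter_upwards [hfa, hfd, hW.eventually_mdiffAt] with q h1 h2 h3
    rw [mlieBracket_smul_right h2 h3, h1]
    rfl
  have hfp := hfd.self_of_nhds
  have hWd := hW.mdiffAt
  have hYW := (hY.mlieBracket hW).mdiffAt
  have hXW := (hX.mlieBracket hW).mdiffAt
  have e1 := Filter.EventuallyEq.mlieBracket_vectorField_eq (I := I) (.refl (𝓝 p) X) eY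
  have e2 := Filter.EventuallyEq.mlieBracket_vectorField_eq (I := I) (.refl (𝓝 p) Y) eX
  rw [e1, e2,
    mlieBracket_add_right (hb.smul_section hWd) (hfp.smul_section hYW),
    mlieBracket_add_right (ha.smul_section hWd) (hfp.smul_section hXW),
    mlieBracket_smul_right hb hWd, mlieBracket_smul_right ha hWd,
    mlieBracket_smul_right hfp hYW, mlieBracket_smul_right hfp hXW,
    mlieBracket_smul_right hfp hWd, key0, hfa.self_of_nhds, hfb.self_of_nhds, hWp] at key
  have : (d% f p (mlieBracket I X Y p) - (d% b p (X p) - d% a p (Y p))) • w = 0 := by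
    rw [← sub_eq_zero] at key
    rw [← neg_eq_zero, ← key]
    module
  rcases smul_eq_zero.1 this with h | h
  · linarith
  · exact absurd h hw

end SmoothFields

section Curvature

variable {E : Type*} [NormedAddCommGroup E] [NormedSpace ℝ E] [FiniteDimensional ℝ E]
  {H : Type*} [TopologicalSpace H] {I : ModelWithCorners ℝ E H}
  {M : Type*} [TopologicalSpace M] [ChartedSpace H M] [IsManifold I ∞ M] [T2Space M]
  [RiemannianBundle (fun x : M => TangentSpace I x)]
  [IsContMDiffRiemannianBundle I ∞ E (fun x : M => TangentSpace I x)]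
  {cov : CovariantDerivative I E (TangentSpace I : M → Type _)}

theorem SmoothNear.inner {X Y : Π x : M, TangentSpace I x} {p : M} (hX : SmoothNear X p)
    (hY : SmoothNear Y p) : ∀ᶠ q in 𝓝 p, CMDiffAt ∞ (fun x => ⟪X x, Y x⟫_ℝ) q := by
  filter_upwards [hX, hY] with q h h'
  exact ContMDiffAt.inner_bundle (E := fun x : M => TangentSpace I x) (b := id) h h'

theorem SmoothNear.inner_mdiffAt {X Y : Π x : M, TangentSpace I x} {p : M} (hX : SmoothNear X p)
    (hY : SmoothNear Y p) : MDiffAt (fun x => ⟪X x, Y x⟫_ℝ) p :=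
  (hX.inner hY).self_of_nhds.mdifferentiableAt (by simp)

namespace IsLeviCivita

variable (hcov : IsLeviCivita cov) {X Y Z : Π x : M, TangentSpace I x} {p : M}
include hcov

theorem mlieBracket_eq (hX : MDiffAt (T% X) p) (hY : MDiffAt (T% Y) p) :
    mlieBracket I X Y p = cov Y p (X p) - cov X p (Y p) :=
  ((cov.torsion_eq_zero_iff.1 hcov.torsionFree) hX hY).symm

theorem inner_curvatureAt_self (hX : SmoothNear X p) (hY : SmoothNear Y p)
    (hZ : SmoothNear Z p) : ⟪curvatureAt cov X Y Z p, Z p⟫_ℝ = 0 := by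
  have hZX := hX.covariantDeriv hcov.smooth hZ
  have hZY := hY.covariantDeriv hcov.smooth hZ
  have hd : ∀ V : Π x : M, TangentSpace I x, ∀ᶠ q in 𝓝 p,
      d% (fun x => ⟪Z x, Z x⟫_ℝ) q (V q) = 2 * ⟪cov Z q (V q), Z q⟫_ℝ := by
    intro V
    filter_upwards [hZ.eventually_mdiffAt] with q hq
    rw [hcov.metric Z Z q (V q) hq hq, real_inner_comm (cov Z q (V q))]
    ring
  have hm : ∀ {V : Π x : M, TangentSpace I x}, SmoothNear (fun q => cov Z q (V q)) p →
      MDiffAt (fun q => 2 * ⟪cov Z q (V q), Z q⟫_ℝ) p :=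
    fun h => mdifferentiableAt_const.mul (h.inner_mdiffAt hZ)
  have key := mvfderiv_mlieBracket hX hY (hZ.inner hZ) (hm hZX) (hm hZY) (hd X) (hd Y)
  rw [(hd (mlieBracket I X Y)).self_of_nhds,
    mvfderiv_fun_mul mdifferentiableAt_const (hZX.inner_mdiffAt hZ),
    mvfderiv_fun_mul mdifferentiableAt_const (hZY.inner_mdiffAt hZ)] at key
  simp only [mvfderiv_const, smul_zero, add_zero, smul_apply, smul_eq_mul,
    hcov.metric _ _ _ _ hZX.mdiffAt hZ.mdiffAt,
    hcov.metric _ _ _ _ hZY.mdiffAt hZ.mdiffAt] at key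
  rw [curvatureAt, inner_sub_left, inner_sub_left]
  have := real_inner_comm (cov Z p (X p)) (cov Z p (Y p))
  linarith

theorem curvatureAt_bianchi (hX : SmoothNear X p) (hY : SmoothNear Y p)
    (hZ : SmoothNear Z p) :
    curvatureAt cov X Y Z p + curvatureAt cov Y Z X p + curvatureAt cov Z X Y p = 0 := by
  have h2 : IsManifold I (minSmoothness ℝ 3) M := isManifold_minSmoothness 3
  have hle : (minSmoothness ℝ 2 : WithTop ℕ∞) ≤ ∞ := by
    simp only [minSmoothness_of_isRCLikeNormedField]
    exact WithTop.coe_le_coe.2 le_top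
  have jac := leibniz_identity_mlieBracket_apply (hX.contMDiffAt.of_le hle)
    (hY.contMDiffAt.of_le hle) (hZ.contMDiffAt.of_le hle)
  have step : ∀ {U V W : Π x : M, TangentSpace I x}, SmoothNear U p → SmoothNear V p →
      SmoothNear W p → mlieBracket I U (mlieBracket I V W) p =
        cov (fun q => cov W q (V q)) p (U p) - cov (fun q => cov V q (W q)) p (U p)
          - cov U p (mlieBracket I V W p) := by
    intro U V W hU hV hW
    have hVW := (hV.covariantDeriv hcov.smooth hW)
    have hWV := (hW.covariantDeriv hcov.smooth hV)
    rw [hcov.mlieBracket_eq hU.mdiffAt (hV.mlieBracket hW).mdiffAt]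
    have e : mlieBracket I V W =ᶠ[𝓝 p]
        ((fun q => cov W q (V q)) - fun q => cov V q (W q)) := by
      filter_upwards [hV.eventually_mdiffAt, hW.eventually_mdiffAt] with q h h'
      rw [hcov.mlieBracket_eq h h']
      rfl
    rw [cov.isCovariantDerivativeOnUniv.congr_of_eventuallyEq (hV.mlieBracket hW).mdiffAt
      (hVW.sub hWV).mdiffAt Filter.univ_mem e]
    have e2 := cov.isCovariantDerivativeOnUniv.add (hVW.sub hWV).mdiffAt hWV.mdiffAt
    rw [sub_add_cancel] at e2
    rw [e2]
    simp
  have j2 : mlieBracket I (mlieBracket I X Y) Z p = - mlieBracket I Z (mlieBracket I X Y) p :=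
    mlieBracket_swap_apply
  have j3 : mlieBracket I Y (mlieBracket I X Z) p = - mlieBracket I Y (mlieBracket I Z X) p := by
    rw [step hY hX hZ, step hY hZ hX, mlieBracket_swap_apply (V := X) (W := Z)]
    simp only [map_neg]
    abel
  rw [j2, j3, step hX hY hZ, step hZ hX hY, step hY hZ hX] at jac
  rw [← sub_eq_zero] at jac
  rw [← jac]
  simp only [curvatureAt]
  abel

end IsLeviCivita

/-- The `(1,2)`-tensor field `T` is smooth and metrically equivalent to a `3`-form. -/
structure IsSmoothThreeForm
    (T : Π x : M, TangentSpace I x →ₗ[ℝ] TangentSpace I x →ₗ[ℝ] TangentSpace I x) : Prop where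
  smooth : ∀ {X Y : Π x : M, TangentSpace I x} {p : M}, CMDiffAt ∞ (T% X) p →
    CMDiffAt ∞ (T% Y) p → CMDiffAt ∞ (T% (fun q => T q (X q) (Y q))) p
  swap : ∀ (p : M) (u v : TangentSpace I p), T p u v = -T p v u
  inner_swap : ∀ (p : M) (u v w : TangentSpace I p), ⟪T p u v, w⟫_ℝ = -⟪T p u w, v⟫_ℝ

namespace IsSmoothThreeForm

variable {T : Π x : M, TangentSpace I x →ₗ[ℝ] TangentSpace I x →ₗ[ℝ] TangentSpace I x}
  (hT : IsSmoothThreeForm T) {p : M}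
include hT

theorem smoothNear {X Y : Π x : M, TangentSpace I x} (hX : SmoothNear X p)
    (hY : SmoothNear Y p) : SmoothNear (fun q => T q (X q) (Y q)) p := by
  filter_upwards [hX, hY] with q h h' using hT.smooth h h'

theorem inner_self_right (u v : TangentSpace I p) : ⟪T p u v, v⟫_ℝ = 0 := by
  have := hT.inner_swap p u v v
  linarith

theorem inner_self_left (u v : TangentSpace I p) : ⟪T p u v, u⟫_ℝ = 0 := by
  rw [hT.swap, inner_neg_left, hT.inner_self_right, neg_zero]

theorem covDerivTensor_swap (w u v : TangentSpace I p) :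
    covDerivTensor cov T p w u v = -covDerivTensor cov T p w v u := by
  have e : (fun q => T q (FiberBundle.extend E u q) (FiberBundle.extend E v q)) =
      (-1 : ℝ) • fun q => T q (FiberBundle.extend E v q) (FiberBundle.extend E u q) := by
    funext q
    rw [hT.swap]
    simp
  have hs := (hT.smoothNear (SmoothNear.extend v) (SmoothNear.extend u)).mdiffAt
  rw [covDerivTensor, covDerivTensor, e, cov.smul_apply (-1) hs, hT.swap p _ v, hT.swap p u,
    neg_one_smul]
  abel

theorem divergence_swap (u v : TangentSpace I p) :
    divergence cov T p u v = -divergence cov T p v u := by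
  simp only [divergence]
  rw [← Finset.sum_neg_distrib]
  refine Finset.sum_congr rfl fun i _ => ?_
  rw [hT.covDerivTensor_swap, inner_neg_right]

theorem inner_curvatureAt_addTensor (hcov : IsLeviCivita cov) (e u v : TangentSpace I p) :
    ⟪curvatureAt (addTensor cov T) (FiberBundle.extend E e) (FiberBundle.extend E u)
        (FiberBundle.extend E v) p, e⟫_ℝ =
      ⟪curvatureAt cov (FiberBundle.extend E e) (FiberBundle.extend E u)
        (FiberBundle.extend E v) p, e⟫_ℝ
      + ⟪e, covDerivTensor cov T p e u v⟫_ℝ - ⟪T p u e, T p v e⟫_ℝ := by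
  set X : Π x : M, TangentSpace I x := FiberBundle.extend E e with hX'
  set U : Π x : M, TangentSpace I x := FiberBundle.extend E u with hU'
  set V : Π x : M, TangentSpace I x := FiberBundle.extend E v with hV'
  have hX : SmoothNear X p := SmoothNear.extend e
  have hU : SmoothNear U p := SmoothNear.extend u
  have hV : SmoothNear V p := SmoothNear.extend v
  have hXp : X p = e := by simp [hX']
  have hUp : U p = u := by simp [hU']
  have hVp : V p = v := by simp [hV']
  have hadd : ∀ {W : Π x : M, TangentSpace I x}, SmoothNear W p → ∀ w : TangentSpace I p,
      addTensor cov T (fun q => addTensor cov T V q (W q)) p w =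
        cov (fun q => cov V q (W q)) p w + cov (fun q => T q (W q) (V q)) p w
          + T p w (cov V p (W p)) + T p w (T p (W p) v) := by
    intro W hW w
    have h1 := hW.covariantDeriv hcov.smooth hV
    have h2 := hT.smoothNear hW hV
    have h3 := cov.isCovariantDerivativeOnUniv.add h1.mdiffAt h2.mdiffAt
    change cov ((fun q => cov V q (W q)) + (fun q => T q (W q) (V q))) p w
      + T p w (cov V p (W p) + T p (W p) (V p)) = _
    rw [h3, hVp, map_add, add_apply]
    abel
  have hder : ∀ w : TangentSpace I p, ⟪cov (fun q => T q (X q) (V q)) p w, e⟫_ℝ =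
      -⟪T p e v, cov X p w⟫_ℝ := by
    intro w
    have h2 := hT.smoothNear hX hV
    have h := hcov.metric _ X p w h2.mdiffAt hX.mdiffAt
    have hz : (fun y => ⟪T y (X y) (V y), X y⟫_ℝ) = fun _ => (0 : ℝ) := by
      funext y
      exact hT.inner_self_left _ _
    rw [hz, mvfderiv_const, hXp, hVp] at h
    simp only [zero_apply] at h
    linarith
  have hT1 : ⟪T p (cov X p u) v, e⟫_ℝ = -⟪T p e v, cov X p u⟫_ℝ := by
    rw [hT.inner_swap, hT.swap, inner_neg_left, neg_neg, hT.inner_swap]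
  have hT2 : ⟪T p u (T p e v), e⟫_ℝ = ⟪T p u e, T p v e⟫_ℝ := by
    rw [hT.inner_swap, hT.swap p e v, inner_neg_right, neg_neg]
  rw [curvatureAt, hXp, hUp, hadd hU, hadd hX, hXp, hUp]
  change ⟪_ - (cov V p (mlieBracket I X U p) + T p (mlieBracket I X U p) (V p)), e⟫_ℝ = _
  rw [curvatureAt, covDerivTensor, ← hU', ← hV', hXp, hUp, hVp,
    hcov.mlieBracket_eq hX.mdiffAt hU.mdiffAt, hXp, hUp]
  simp only [map_sub, LinearMap.sub_apply, inner_add_left, inner_sub_left,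
    hT.inner_self_left, hder, hT1, hT2, real_inner_comm _ e]
  ring

theorem ricci_addTensor_sub (hcov : IsLeviCivita cov) (u v : TangentSpace I p) :
    ricci (addTensor cov T) p u v - ricci (addTensor cov T) p v u
      = 2 * divergence cov T p u v := by
  have h2 : divergence cov T p u v = divergence cov T p u v / 2 - divergence cov T p v u / 2 := by
    rw [hT.divergence_swap v u]
    ring
  rw [h2]
  simp only [ricci, divergence]
  rw [← Finset.sum_sub_distrib, Finset.sum_div, Finset.sum_div, ← Finset.sum_sub_distrib,
    Finset.mul_sum]
  refine Finset.sum_congr rfl fun i _ => ?_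
  set e := stdOrthonormalBasis ℝ (TangentSpace I p) i
  have hX : SmoothNear (FiberBundle.extend E e) p := SmoothNear.extend e
  have hU : SmoothNear (FiberBundle.extend E u) p := SmoothNear.extend u
  have hV : SmoothNear (FiberBundle.extend E v) p := SmoothNear.extend v
  have hb := congrArg (fun x => ⟪x, e⟫_ℝ) (hcov.curvatureAt_bianchi hX hU hV)
  have hs := hcov.inner_curvatureAt_self hU hV hX
  have hsw : curvatureAt cov (FiberBundle.extend E v) (FiberBundle.extend E e)
      (FiberBundle.extend E u) p = -curvatureAt cov (FiberBundle.extend E e)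
      (FiberBundle.extend E v) (FiberBundle.extend E u) p := by
    simp only [curvatureAt]
    rw [mlieBracket_swap_apply, map_neg]
    abel
  rw [FiberBundle.extend_apply_self] at hs
  simp only [inner_add_left, hsw, inner_neg_left, hs, inner_zero_left] at hb
  rw [hT.inner_curvatureAt_addTensor hcov, hT.inner_curvatureAt_addTensor hcov,
    hT.covDerivTensor_swap e v u, inner_neg_right,
    real_inner_comm (T p u e) (T p v e)]
  linarith

theorem hasSymmetricRicci_iff (hcov : IsLeviCivita cov) :
    HasSymmetricRicci (addTensor cov T) ↔ HasZeroDivergence cov T := by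
  refine forall_congr' fun p => forall_congr' fun u => forall_congr' fun v => ?_
  have := hT.ricci_addTensor_sub hcov u v
  constructor <;> intro h <;> linarith

end IsSmoothThreeForm

end Curvature

section Divergence

variable {E : Type*} [NormedAddCommGroup E] [NormedSpace ℝ E] [FiniteDimensional ℝ E]
  {H : Type*} [TopologicalSpace H] {I : ModelWithCorners ℝ E H}
  {M : Type*} [TopologicalSpace M] [ChartedSpace H M] [IsManifold I ∞ M] [T2Space M]
  [RiemannianBundle (fun x : M => TangentSpace I x)]
  {cov : CovariantDerivative I E (TangentSpace I : M → Type _)}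

/-- The field of endomorphisms `φ` maps smooth vector fields to smooth vector fields. -/
def PreservesSmooth (φ : Π x : M, TangentSpace I x →L[ℝ] TangentSpace I x) : Prop :=
  ∀ ⦃X : Π x : M, TangentSpace I x⦄ ⦃p : M⦄, CMDiffAt ∞ (T% X) p →
    CMDiffAt ∞ (T% (fun q => φ q (X q))) p

theorem PreservesSmooth.smoothNear {φ : Π x : M, TangentSpace I x →L[ℝ] TangentSpace I x}
    (hφ : PreservesSmooth φ) {X : Π x : M, TangentSpace I x} {p : M} (hX : SmoothNear X p) :
    SmoothNear (fun q => φ q (X q)) p := hX.mono fun _ h => hφ h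

/-- The field of endomorphisms `φ` is skew-symmetric. -/
def IsSkewField (φ : Π x : M, TangentSpace I x →L[ℝ] TangentSpace I x) : Prop :=
  ∀ (x : M) (u v : TangentSpace I x), ⟪φ x u, v⟫_ℝ = -⟪u, φ x v⟫_ℝ

theorem torsionOf_apply {φ : Π x : M, TangentSpace I x →L[ℝ] TangentSpace I x}
    (hφ : IsSkewField φ) (ξ : Π x : M, TangentSpace I x) (x : M) (u v : TangentSpace I x) :
    torsionOf ξ φ x u v =
      -(⟪ξ x, u⟫_ℝ • φ x v) + ⟪ξ x, v⟫_ℝ • φ x u + ⟪u, φ x v⟫_ℝ • ξ x := by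
  refine ext_inner_right ℝ fun z => ?_
  rw [torsionOf, inner_raiseLast, wedge₁₂_apply]
  simp only [etaOf, endoForm_apply, innerₗ_apply_apply, inner_add_left, inner_neg_left,
    real_inner_smul_left, ContinuousLinearMap.coe_coe]
  rw [hφ x v z, real_inner_comm (φ x u) z]
  ring

/-- The covariant derivative `w ↦ (∇_w φ) v` of a field of endomorphisms, where `v` is extended to
a local smooth vector field. -/
def endoDeriv (cov : CovariantDerivative I E (TangentSpace I : M → Type _))
    (φ : Π x : M, TangentSpace I x →L[ℝ] TangentSpace I x) (p : M) (v : TangentSpace I p) :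
    TangentSpace I p →ₗ[ℝ] TangentSpace I p :=
  (cov (fun q => φ q (FiberBundle.extend E v q)) p : TangentSpace I p →ₗ[ℝ] TangentSpace I p)
    - (φ p : TangentSpace I p →ₗ[ℝ] TangentSpace I p) ∘ₗ
      (cov (FiberBundle.extend E v) p : TangentSpace I p →ₗ[ℝ] TangentSpace I p)

theorem endoDeriv_apply (φ : Π x : M, TangentSpace I x →L[ℝ] TangentSpace I x) (p : M)
    (v w : TangentSpace I p) :
    endoDeriv cov φ p v w = cov (fun q => φ q (FiberBundle.extend E v q)) p w
      - φ p (cov (FiberBundle.extend E v) p w) := rfl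

section Linear

variable {T S : Π x : M, TangentSpace I x →ₗ[ℝ] TangentSpace I x →ₗ[ℝ] TangentSpace I x} {p : M}

theorem divergence_add {u v : TangentSpace I p}
    (hT : MDiffAt (T% (fun q => T q (FiberBundle.extend E u q) (FiberBundle.extend E v q))) p)
    (hS : MDiffAt (T% (fun q => S q (FiberBundle.extend E u q) (FiberBundle.extend E v q))) p) :
    divergence cov (fun x => T x + S x) p u v = divergence cov T p u v + divergence cov S p u v := by
  simp only [divergence]
  rw [← Finset.sum_add_distrib]
  refine Finset.sum_congr rfl fun i _ => ?_
  rw [← inner_add_right]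
  congr 1
  have := cov.add_apply hT hS
  simp only [covDerivTensor, LinearMap.add_apply]
  erw [this]
  abel

theorem divergence_smul (a : ℝ) {u v : TangentSpace I p}
    (hT : MDiffAt (T% (fun q => T q (FiberBundle.extend E u q) (FiberBundle.extend E v q))) p) :
    divergence cov (fun x => a • T x) p u v = a * divergence cov T p u v := by
  simp only [divergence]
  rw [Finset.mul_sum]
  refine Finset.sum_congr rfl fun i _ => ?_
  rw [← real_inner_smul_right]
  congr 1
  have := cov.smul_apply a hT
  simp only [covDerivTensor, LinearMap.smul_apply]
  erw [this]
  simp only [smul_sub]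

end Linear

variable [IsContMDiffRiemannianBundle I ∞ E (fun x : M => TangentSpace I x)]

theorem isSmoothThreeForm_torsionOf {φ : Π x : M, TangentSpace I x →L[ℝ] TangentSpace I x}
    (hφ : PreservesSmooth φ) (hφ' : IsSkewField φ) {ξ : Π x : M, TangentSpace I x}
    (hξ : CMDiff ∞ (T% ξ)) : IsSmoothThreeForm (torsionOf ξ φ) where
  smooth {X Y p} hX hY := by
    simp only [torsionOf_apply hφ']
    have hi : ∀ {U V : Π x : M, TangentSpace I x}, CMDiffAt ∞ (T% U) p → CMDiffAt ∞ (T% V) p →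
        CMDiffAt ∞ (fun x => ⟪U x, V x⟫_ℝ) p := fun h h' =>
      ContMDiffAt.inner_bundle (E := fun x : M => TangentSpace I x) (b := id) h h'
    exact ((((hi (hξ p) hX).smul_section (hφ hY)).neg_section).add_section
      ((hi (hξ p) hY).smul_section (hφ hX))).add_section ((hi hX (hφ hY)).smul_section (hξ p))
  swap p u v := by
    rw [torsionOf_apply hφ', torsionOf_apply hφ', real_inner_comm (φ p v) u, hφ' p v u]
    module
  inner_swap p u v w := by
    rw [torsionOf_apply hφ', torsionOf_apply hφ']
    simp only [inner_add_left, inner_neg_left, real_inner_smul_left]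
    rw [hφ' p v w, real_inner_comm (φ p w) v, hφ' p u w, hφ' p u v]
    ring

variable {ξ : Π x : M, TangentSpace I x}
    {φ : Π x : M, TangentSpace I x →L[ℝ] TangentSpace I x}

theorem covDerivTensor_torsionOf (hcov : IsLeviCivita cov) (hφ : PreservesSmooth φ)
    (hφ' : IsSkewField φ) (hξ : CMDiff ∞ (T% ξ)) (p : M) (w u v : TangentSpace I p) :
    covDerivTensor cov (torsionOf ξ φ) p w u v =
      -(⟪ξ p, u⟫_ℝ • endoDeriv cov φ p v w) - ⟪cov ξ p w, u⟫_ℝ • φ p v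
      + ⟪ξ p, v⟫_ℝ • endoDeriv cov φ p u w + ⟪cov ξ p w, v⟫_ℝ • φ p u
      + ⟪u, φ p v⟫_ℝ • cov ξ p w + ⟪u, endoDeriv cov φ p v w⟫_ℝ • ξ p := by
  set U : Π x : M, TangentSpace I x := FiberBundle.extend E u with hU'
  set V : Π x : M, TangentSpace I x := FiberBundle.extend E v with hV'
  have hU : SmoothNear U p := SmoothNear.extend u
  have hV : SmoothNear V p := SmoothNear.extend v
  have hξn : SmoothNear ξ p := Filter.Eventually.of_forall hξ
  have hUp : U p = u := by simp [hU']
  have hVp : V p = v := by simp [hV']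
  have hφU := hφ.smoothNear hU
  have hφV := hφ.smoothNear hV
  have e : (fun q => torsionOf ξ φ q (U q) (V q)) =
      ((-1 : ℝ) • ((fun q => ⟪ξ q, U q⟫_ℝ) • fun q => φ q (V q))
        + (fun q => ⟪ξ q, V q⟫_ℝ) • fun q => φ q (U q))
        + (fun q => ⟪U q, φ q (V q)⟫_ℝ) • ξ := by
    funext q
    rw [torsionOf_apply hφ']
    simp
  have d1 := (hξn.inner_mdiffAt hU)
  have d2 := (hξn.inner_mdiffAt hV)
  have d3 := (hU.inner_mdiffAt hφV)
  have s1 := d1.smul_section hφV.mdiffAt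
  have s2 := d2.smul_section hφU.mdiffAt
  have s3 := d3.smul_section hξn.mdiffAt
  have s0 : MDiffAt (T% ((-1 : ℝ) • ((fun q => ⟪ξ q, U q⟫_ℝ) • fun q => φ q (V q)))) p :=
    (mdifferentiableAt_const (c := (-1 : ℝ))).smul_section s1
  rw [covDerivTensor, ← hU', ← hV', e, cov.add_apply (mdifferentiableAt_add_section s0 s2) s3,
    cov.add_apply s0 s2, cov.smul_apply _ s1, cov.leibniz_apply d1 hφV.mdiffAt,
    cov.leibniz_apply d2 hφU.mdiffAt, cov.leibniz_apply d3 hξn.mdiffAt,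
    hcov.metric _ _ _ _ hξn.mdiffAt hU.mdiffAt, hcov.metric _ _ _ _ hξn.mdiffAt hV.mdiffAt,
    hcov.metric _ _ _ _ hU.mdiffAt hφV.mdiffAt, torsionOf_apply hφ', torsionOf_apply hφ',
    endoDeriv_apply, endoDeriv_apply, ← hU', ← hV', hUp, hVp, inner_sub_right]
  module

/-- The divergence of the tensor metrically equivalent to `η ∧ Φ`, for a Killing field `ξ`. -/
theorem divergence_torsionOf (hcov : IsLeviCivita cov) (hφ : PreservesSmooth φ)
    (hφ' : IsSkewField φ) (hξ : CMDiff ∞ (T% ξ)) (p : M)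
    (hk : ∀ u v : TangentSpace I p, ⟪cov ξ p u, v⟫_ℝ + ⟪u, cov ξ p v⟫_ℝ = 0)
    (u v : TangentSpace I p) :
    divergence cov (torsionOf ξ φ) p u v =
      ⟪cov ξ p u, φ p v⟫_ℝ - ⟪cov ξ p v, φ p u⟫_ℝ
      - ⟪ξ p, u⟫_ℝ * LinearMap.trace ℝ _ (endoDeriv cov φ p v)
      + ⟪ξ p, v⟫_ℝ * LinearMap.trace ℝ _ (endoDeriv cov φ p u)
      + ⟪u, endoDeriv cov φ p v (ξ p)⟫_ℝ := by
  set b := stdOrthonormalBasis ℝ (TangentSpace I p)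
  have hk0 : ∀ w, ⟪w, cov ξ p w⟫_ℝ = 0 := fun w => by
    have := hk w w
    rw [real_inner_comm] at this
    linarith
  have hk1 : ∀ w z, ⟪cov ξ p w, z⟫_ℝ = -⟪w, cov ξ p z⟫_ℝ := fun w z => by linarith [hk w z]
  have hD : ⟪u, endoDeriv cov φ p v (ξ p)⟫_ℝ =
      ∑ i, ⟪b i, ξ p⟫_ℝ * ⟪u, endoDeriv cov φ p v (b i)⟫_ℝ := by
    conv_lhs => rw [← b.sum_repr' (ξ p)]
    simp only [map_sum, map_smul, inner_sum, real_inner_smul_right]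
  rw [LinearMap.trace_eq_sum_inner _ b, LinearMap.trace_eq_sum_inner _ b, hD, divergence,
    real_inner_comm (φ p v), real_inner_comm (φ p u), ← b.sum_inner_mul_inner (φ p v),
    ← b.sum_inner_mul_inner (φ p u), Finset.mul_sum, Finset.mul_sum]
  simp only [← Finset.sum_sub_distrib, ← Finset.sum_add_distrib]
  refine Finset.sum_congr rfl fun i _ => ?_
  rw [covDerivTensor_torsionOf hcov hφ hφ' hξ]
  simp only [inner_add_right, inner_sub_right, inner_neg_right, real_inner_smul_right, hk0, hk1]
  rw [real_inner_comm (b i) (φ p v), real_inner_comm (b i) (φ p u)]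
  ring

end Divergence

section Sasakian

variable {E : Type*} [NormedAddCommGroup E] [NormedSpace ℝ E] [FiniteDimensional ℝ E]
  {H : Type*} [TopologicalSpace H] {I : ModelWithCorners ℝ E H}
  {M : Type*} [TopologicalSpace M] [ChartedSpace H M] [IsManifold I ∞ M] [T2Space M]
  [RiemannianBundle (fun x : M => TangentSpace I x)]
  [IsContMDiffRiemannianBundle I ∞ E (fun x : M => TangentSpace I x)]
  {cov : CovariantDerivative I E (TangentSpace I : M → Type _)}

theorem phiOf_apply (ξ : Π x : M, TangentSpace I x) (x : M) (u : TangentSpace I x) :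
    phiOf cov ξ x u = -cov ξ x u := rfl

theorem covariantDeriv_eq_neg_phiOf (ξ : Π x : M, TangentSpace I x) (x : M)
    (u : TangentSpace I x) : cov ξ x u = -phiOf cov ξ x u := by
  rw [phiOf_apply, neg_neg]

namespace IsSasakian

variable {ξ : Π x : M, TangentSpace I x} (h : IsSasakian cov ξ)
include h

theorem smoothNear (p : M) : SmoothNear ξ p := Filter.Eventually.of_forall h.smooth

theorem preservesSmooth (hcov : IsLeviCivita cov) : PreservesSmooth (phiOf cov ξ) := by
  intro X p hX
  have := (CovariantDerivative.contMDiffAt_of_smoothNear hcov.smooth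
    (h.smoothNear p)).clm_bundle_apply hX
  exact this.neg_section

theorem isSkewField : IsSkewField (phiOf cov ξ) := by
  intro x u v
  have := h.killing x u v
  rw [phiOf_apply, phiOf_apply, inner_neg_left, inner_neg_right]
  linarith

theorem phi_self (hcov : IsLeviCivita cov) (p : M) : phiOf cov ξ p (ξ p) = 0 := by
  refine ext_inner_left ℝ fun w => ?_
  have hm := hcov.metric ξ ξ p w (h.smoothNear p).mdiffAt (h.smoothNear p).mdiffAt
  have h1 : (fun y => ⟪ξ y, ξ y⟫_ℝ) = fun _ => (1 : ℝ) := funext h.unit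
  rw [h1, mvfderiv_const, zero_apply, real_inner_comm (cov ξ p w)] at hm
  have hk := h.killing p w (ξ p)
  rw [phiOf_apply, inner_neg_right, inner_zero_right]
  linarith

theorem endoDeriv_phiOf (p : M) (v w : TangentSpace I p) :
    endoDeriv cov (phiOf cov ξ) p v w = ⟪w, v⟫_ℝ • ξ p - ⟪ξ p, v⟫_ℝ • w := by
  have := h.nabla_phi (FiberBundle.extend E w) (FiberBundle.extend E v) p
    (SmoothNear.extend w).mdiffAt (SmoothNear.extend v).mdiffAt
  simp only [FiberBundle.extend_apply_self, etaOf, innerₗ_apply_apply] at this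
  exact this

theorem trace_endoDeriv_phiOf (p : M) (v : TangentSpace I p) :
    LinearMap.trace ℝ _ (endoDeriv cov (phiOf cov ξ) p v)
      = -((Module.finrank ℝ E : ℝ) - 1) * ⟪ξ p, v⟫_ℝ := by
  set b := stdOrthonormalBasis ℝ (TangentSpace I p)
  have h1 : ∀ i, ⟪b i, b i⟫_ℝ = 1 := fun i => by simp
  have h2 : (Module.finrank ℝ (TangentSpace I p)) = Module.finrank ℝ E := rfl
  rw [LinearMap.trace_eq_sum_inner _ b]
  simp only [h.endoDeriv_phiOf, inner_sub_right, real_inner_smul_right, h1, mul_one,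
    Finset.sum_sub_distrib, Finset.sum_const, Finset.card_univ, Fintype.card_fin, h2, nsmul_eq_mul]
  have h3 := b.sum_inner_mul_inner (ξ p) v
  simp only [mul_comm, real_inner_comm (ξ p)] at h3 ⊢
  rw [h3]
  ring

theorem divergence_torsionOf_phiOf {ζ : Π x : M, TangentSpace I x} (hζ : IsSasakian cov ζ)
    (hcov : IsLeviCivita cov) (p : M) (u v : TangentSpace I p) :
    divergence cov (torsionOf ξ (phiOf cov ζ)) p u v =
      ⟪u, phiOf cov ξ p (phiOf cov ζ p v)⟫_ℝ - ⟪u, phiOf cov ζ p (phiOf cov ξ p v)⟫_ℝ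
      + ((Module.finrank ℝ E : ℝ) - 2) * (⟪ξ p, u⟫_ℝ * ⟪ζ p, v⟫_ℝ - ⟪ξ p, v⟫_ℝ * ⟪ζ p, u⟫_ℝ) := by
  rw [divergence_torsionOf hcov (hζ.preservesSmooth hcov) hζ.isSkewField h.smooth p (h.killing p),
    hζ.trace_endoDeriv_phiOf, hζ.trace_endoDeriv_phiOf, hζ.endoDeriv_phiOf,
    covariantDeriv_eq_neg_phiOf ξ p u, covariantDeriv_eq_neg_phiOf ξ p v, inner_neg_left,
    inner_neg_left, h.isSkewField p u, real_inner_comm (phiOf cov ζ p u), hζ.isSkewField p u,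
    inner_sub_right, real_inner_smul_right, real_inner_smul_right, real_inner_comm (ζ p) u,
    real_inner_comm (ξ p) u]
  ring

end IsSasakian

namespace IsThreeSasakian

variable {ξ : Fin 3 → Π x : M, TangentSpace I x} (h : IsThreeSasakian cov ξ)
  (hcov : IsLeviCivita cov)
include h

theorem inner_self (r : Fin 3) (p : M) : ⟪ξ r p, ξ r p⟫_ℝ = 1 := (h.sasakian r).unit p

theorem inner_ne {r s : Fin 3} (hrs : r ≠ s) (p : M) : ⟪ξ r p, ξ s p⟫_ℝ = 0 :=
  (h.orthonormal p).2 hrs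

include hcov

theorem phi_apply_swap {r s : Fin 3} (hrs : r ≠ s) (p : M) :
    phiOf cov (ξ r) p (ξ s p) = -phiOf cov (ξ s) p (ξ r p) := by
  refine ext_inner_left ℝ fun w => ?_
  have hm := hcov.metric (ξ r) (ξ s) p w ((h.sasakian r).smoothNear p).mdiffAt
    ((h.sasakian s).smoothNear p).mdiffAt
  have h1 : (fun y => ⟪ξ r y, ξ s y⟫_ℝ) = fun _ => (0 : ℝ) := funext (h.inner_ne hrs)
  rw [h1, mvfderiv_const, zero_apply, real_inner_comm (cov (ξ s) p w)] at hm
  have hr := (h.sasakian r).killing p w (ξ s p)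
  have hs := (h.sasakian s).killing p w (ξ r p)
  rw [phiOf_apply, phiOf_apply, inner_neg_right, inner_neg_right, inner_neg_right]
  linarith

theorem phi_next (r : Fin 3) (p : M) : phiOf cov (ξ r) p (ξ (r + 1) p) = ξ (r + 2) p := by
  have hb := h.bracket r p
  rw [hcov.mlieBracket_eq ((h.sasakian r).smoothNear p).mdiffAt
    ((h.sasakian (r + 1)).smoothNear p).mdiffAt, covariantDeriv_eq_neg_phiOf,
    covariantDeriv_eq_neg_phiOf, h.phi_apply_swap hcov (r := r + 1) (s := r) (by fin_cases r <;> decide)]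
    at hb
  have : (2 : ℝ) • phiOf cov (ξ r) p (ξ (r + 1) p) = (2 : ℝ) • ξ (r + 2) p := by
    rw [← hb]
    module
  exact smul_right_injective _ two_ne_zero this

theorem phi_next' (r : Fin 3) (p : M) : phiOf cov (ξ (r + 1)) p (ξ r p) = -ξ (r + 2) p := by
  rw [h.phi_apply_swap hcov (by fin_cases r <;> decide), h.phi_next hcov]

theorem phi_phi (r : Fin 3) (p : M) (w : TangentSpace I p) :
    phiOf cov (ξ r) p (phiOf cov (ξ (r + 1)) p w) =
      phiOf cov (ξ (r + 2)) p w + ⟪ξ (r + 1) p, w⟫_ℝ • ξ r p := by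
  have hn := (h.sasakian r).nabla_phi (FiberBundle.extend E w) (ξ (r + 1)) p
    (SmoothNear.extend w).mdiffAt ((h.sasakian (r + 1)).smoothNear p).mdiffAt
  have he : (fun y => phiOf cov (ξ r) y (ξ (r + 1) y)) = ξ (r + 2) := funext (h.phi_next hcov r)
  rw [he, FiberBundle.extend_apply_self, covariantDeriv_eq_neg_phiOf, covariantDeriv_eq_neg_phiOf,
    etaOf, innerₗ_apply_apply, h.inner_ne (by fin_cases r <;> decide), zero_smul, sub_zero, map_neg,
    real_inner_comm (ξ (r + 1) p) w] at hn
  rw [← hn]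
  abel

theorem phi_phi' (r : Fin 3) (p : M) (w : TangentSpace I p) :
    phiOf cov (ξ (r + 1)) p (phiOf cov (ξ r) p w) =
      -phiOf cov (ξ (r + 2)) p w + ⟪ξ r p, w⟫_ℝ • ξ (r + 1) p := by
  have hn := (h.sasakian (r + 1)).nabla_phi (FiberBundle.extend E w) (ξ r) p
    (SmoothNear.extend w).mdiffAt ((h.sasakian r).smoothNear p).mdiffAt
  have he : (fun y => phiOf cov (ξ (r + 1)) y (ξ r y)) = (-1 : ℝ) • ξ (r + 2) :=
    funext fun y => by rw [h.phi_next' hcov r]; simp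
  rw [he, cov.smul_apply _ ((h.sasakian (r + 2)).smoothNear p).mdiffAt,
    FiberBundle.extend_apply_self, covariantDeriv_eq_neg_phiOf, covariantDeriv_eq_neg_phiOf,
    etaOf, innerₗ_apply_apply, h.inner_ne (by fin_cases r <;> decide), zero_smul, sub_zero, map_neg,
    real_inner_comm (ξ r p) w] at hn
  rw [← hn]
  module

theorem divergence_torsionRS_self (r : Fin 3) : HasZeroDivergence cov (torsionRS cov ξ r r) := by
  intro p u v
  change divergence cov (torsionOf (ξ r) (phiOf cov (ξ r))) p u v = 0
  rw [(h.sasakian r).divergence_torsionOf_phiOf (h.sasakian r) hcov]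
  ring

theorem divergence_torsionRS_next (r : Fin 3) (p : M) (u v : TangentSpace I p) :
    divergence cov (torsionRS cov ξ r (r + 1)) p u v =
      2 * PhiOf cov (ξ (r + 2)) p u v
        + ((Module.finrank ℝ E : ℝ) - 1) * wedge₁₁ (etaOf (ξ r) p) (etaOf (ξ (r + 1)) p) u v := by
  change divergence cov (torsionOf (ξ r) (phiOf cov (ξ (r + 1)))) p u v = _
  rw [(h.sasakian r).divergence_torsionOf_phiOf (h.sasakian (r + 1)) hcov, h.phi_phi hcov,
    h.phi_phi' hcov, wedge₁₁_apply, PhiOf, endoForm_apply]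
  simp only [inner_add_right, inner_neg_right, real_inner_smul_right, etaOf, innerₗ_apply_apply,
    ContinuousLinearMap.coe_coe, real_inner_comm u]
  ring

theorem divergence_torsionRS_prev (r : Fin 3) (p : M) (u v : TangentSpace I p) :
    divergence cov (torsionRS cov ξ r (r + 2)) p u v =
      -2 * PhiOf cov (ξ (r + 1)) p u v
        + ((Module.finrank ℝ E : ℝ) - 1) * wedge₁₁ (etaOf (ξ r) p) (etaOf (ξ (r + 2)) p) u v := by
  obtain ⟨s, rfl⟩ : ∃ s : Fin 3, r = s + 1 := ⟨r + 2, by fin_cases r <;> rfl⟩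
  rw [show s + 1 + 2 = s by fin_cases s <;> rfl, show s + 1 + 1 = s + 2 by fin_cases s <;> rfl]
  change divergence cov (torsionOf (ξ (s + 1)) (phiOf cov (ξ s))) p u v = _
  rw [(h.sasakian (s + 1)).divergence_torsionOf_phiOf (h.sasakian s) hcov, h.phi_phi hcov,
    h.phi_phi' hcov, wedge₁₁_apply, PhiOf, endoForm_apply]
  simp only [inner_add_right, inner_neg_right, real_inner_smul_right, etaOf, innerₗ_apply_apply,
    ContinuousLinearMap.coe_coe, real_inner_comm u]
  ring

/-- The field of endomorphisms `η_2 ⊗ ξ_1 - η_1 ⊗ ξ_2`. -/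
def verticalRotation (ξ : Fin 3 → Π x : M, TangentSpace I x) (x : M) :
    TangentSpace I x →L[ℝ] TangentSpace I x :=
  LinearMap.toContinuousLinearMap
    ((etaOf (ξ 2) x).smulRight (ξ 1 x) - (etaOf (ξ 1) x).smulRight (ξ 2 x))

omit [T2Space M] [IsContMDiffRiemannianBundle I ∞ E (fun x : M => TangentSpace I x)] h hcov in
theorem verticalRotation_apply (ξ : Fin 3 → Π x : M, TangentSpace I x) (x : M)
    (u : TangentSpace I x) :
    verticalRotation ξ x u = ⟪ξ 2 x, u⟫_ℝ • ξ 1 x - ⟪ξ 1 x, u⟫_ℝ • ξ 2 x := rfl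

omit [T2Space M] [IsContMDiffRiemannianBundle I ∞ E (fun x : M => TangentSpace I x)] h hcov in
theorem torsionO_eq (ξ : Fin 3 → Π x : M, TangentSpace I x) :
    torsionO ξ = torsionOf (ξ 0) (verticalRotation ξ) := by
  funext x
  rw [torsionO, torsionOf]
  congr 2
  ext u v
  rw [wedge₁₁_apply, endoForm_apply, ContinuousLinearMap.coe_coe, verticalRotation_apply,
    inner_sub_right, real_inner_smul_right, real_inner_smul_right, real_inner_comm (ξ 1 x) u,
    real_inner_comm (ξ 2 x) u]
  simp only [etaOf, innerₗ_apply_apply]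
  ring

omit [T2Space M] [IsContMDiffRiemannianBundle I ∞ E (fun x : M => TangentSpace I x)] h hcov in
theorem isSkewField_verticalRotation (ξ : Fin 3 → Π x : M, TangentSpace I x) :
    IsSkewField (verticalRotation ξ) := by
  intro x u v
  simp only [verticalRotation_apply, inner_sub_left, inner_sub_right, real_inner_smul_left,
    real_inner_smul_right, real_inner_comm u]
  ring

omit hcov in
theorem preservesSmooth_verticalRotation : PreservesSmooth (verticalRotation ξ) := by
  intro X p hX
  have hi : ∀ r, CMDiffAt ∞ (fun x => ⟪ξ r x, X x⟫_ℝ) p := fun r =>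
    ContMDiffAt.inner_bundle (E := fun x : M => TangentSpace I x) (b := id)
      ((h.sasakian r).smooth p) hX
  exact ((hi 2).smul_section ((h.sasakian 1).smooth p)).sub_section
    ((hi 1).smul_section ((h.sasakian 2).smooth p))

theorem endoDeriv_verticalRotation (p : M) (v w : TangentSpace I p) :
    endoDeriv cov (verticalRotation ξ) p v w =
      ⟪cov (ξ 2) p w, v⟫_ℝ • ξ 1 p + ⟪ξ 2 p, v⟫_ℝ • cov (ξ 1) p w
        - ⟪cov (ξ 1) p w, v⟫_ℝ • ξ 2 p - ⟪ξ 1 p, v⟫_ℝ • cov (ξ 2) p w := by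
  have hV : SmoothNear (FiberBundle.extend E v) p := SmoothNear.extend v
  have hs := fun r => (h.sasakian r).smoothNear p
  have d := fun r => (hs r).inner_mdiffAt hV
  have e : (fun q => verticalRotation ξ q (FiberBundle.extend E v q)) =
      (fun q => ⟪ξ 2 q, FiberBundle.extend E v q⟫_ℝ) • ξ 1
        + (-1 : ℝ) • ((fun q => ⟪ξ 1 q, FiberBundle.extend E v q⟫_ℝ) • ξ 2) := by
    funext q
    rw [verticalRotation_apply]
    simp only [Pi.add_apply, Pi.smul_apply, Pi.smul_apply']
    module
  have s2 := (d 2).smul_section (hs 1).mdiffAt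
  have s1 := (d 1).smul_section (hs 2).mdiffAt
  have s1' : MDiffAt (T% ((-1 : ℝ) • ((fun q => ⟪ξ 1 q, FiberBundle.extend E v q⟫_ℝ) • ξ 2))) p :=
    (mdifferentiableAt_const (c := (-1 : ℝ))).smul_section s1
  rw [endoDeriv_apply, e, cov.add_apply s2 s1', cov.smul_apply _ s1,
    cov.leibniz_apply (d 2) (hs 1).mdiffAt, cov.leibniz_apply (d 1) (hs 2).mdiffAt,
    hcov.metric _ _ _ _ (hs 2).mdiffAt hV.mdiffAt, hcov.metric _ _ _ _ (hs 1).mdiffAt hV.mdiffAt,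
    verticalRotation_apply, FiberBundle.extend_apply_self]
  module

theorem phi_vertical (p : M) :
    phiOf cov (ξ 0) p (ξ 1 p) = ξ 2 p ∧ phiOf cov (ξ 1) p (ξ 2 p) = ξ 0 p ∧
    phiOf cov (ξ 2) p (ξ 0 p) = ξ 1 p ∧ phiOf cov (ξ 1) p (ξ 0 p) = -ξ 2 p ∧
    phiOf cov (ξ 2) p (ξ 1 p) = -ξ 0 p ∧ phiOf cov (ξ 0) p (ξ 2 p) = -ξ 1 p :=
  ⟨h.phi_next hcov 0 p, h.phi_next hcov 1 p, h.phi_next hcov 2 p, h.phi_next' hcov 0 p,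
    h.phi_next' hcov 1 p, h.phi_next' hcov 2 p⟩

theorem trace_endoDeriv_verticalRotation (p : M) (v : TangentSpace I p) :
    LinearMap.trace ℝ _ (endoDeriv cov (verticalRotation ξ) p v) = 2 * ⟪ξ 0 p, v⟫_ℝ := by
  set b := stdOrthonormalBasis ℝ (TangentSpace I p)
  obtain ⟨h01, h12, h20, h10, h21, h02⟩ := h.phi_vertical hcov p
  have hk : ∀ r i, ⟪b i, cov (ξ r) p (b i)⟫_ℝ = 0 := fun r i => by
    have := (h.sasakian r).killing p (b i) (b i)
    rw [real_inner_comm] at this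
    linarith
  have hA : ∀ r s, ∑ i, ⟪cov (ξ r) p (b i), v⟫_ℝ * ⟪b i, ξ s p⟫_ℝ =
      ⟪cov (ξ r) p (ξ s p), v⟫_ℝ := fun r s => by
    conv_rhs => rw [← b.sum_repr' (ξ s p)]
    simp only [map_sum, map_smul, sum_inner, real_inner_smul_left, mul_comm]
  rw [LinearMap.trace_eq_sum_inner _ b]
  simp only [h.endoDeriv_verticalRotation hcov, inner_sub_right, inner_add_right,
    real_inner_smul_right, hk, mul_zero, add_zero, sub_zero, Finset.sum_sub_distrib, hA]
  rw [covariantDeriv_eq_neg_phiOf, covariantDeriv_eq_neg_phiOf, h21, h12, neg_neg, inner_neg_left]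
  ring

theorem divergence_torsionO : HasZeroDivergence cov (torsionO ξ) := by
  intro p u v
  obtain ⟨h01, h12, h20, h10, h21, h02⟩ := h.phi_vertical hcov p
  rw [torsionO_eq, divergence_torsionOf hcov h.preservesSmooth_verticalRotation
    (isSkewField_verticalRotation ξ) (h.sasakian 0).smooth p ((h.sasakian 0).killing p),
    h.trace_endoDeriv_verticalRotation hcov, h.trace_endoDeriv_verticalRotation hcov,
    h.endoDeriv_verticalRotation hcov, verticalRotation_apply, verticalRotation_apply]
  have hk := fun w z => (h.sasakian 0).isSkewField p w z
  simp only [covariantDeriv_eq_neg_phiOf, h20, h10, inner_neg_left, inner_sub_right, map_smul,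
    inner_add_right, real_inner_smul_right, smul_neg, neg_neg, inner_neg_right, hk, h01, h02,
    real_inner_comm u]
  rw [real_inner_comm v (ξ 1 p), real_inner_comm v (ξ 2 p)]
  ring

end IsThreeSasakian

namespace IsSmoothThreeForm

variable {T S : Π x : M, TangentSpace I x →ₗ[ℝ] TangentSpace I x →ₗ[ℝ] TangentSpace I x}

theorem mdiffAt (hT : IsSmoothThreeForm T) {p : M} (u v : TangentSpace I p) :
    MDiffAt (T% (fun q => T q (FiberBundle.extend E u q) (FiberBundle.extend E v q))) p :=
  (hT.smoothNear (SmoothNear.extend u) (SmoothNear.extend v)).mdiffAt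

theorem add (hT : IsSmoothThreeForm T) (hS : IsSmoothThreeForm S) :
    IsSmoothThreeForm fun x => T x + S x where
  smooth hX hY := (hT.smooth hX hY).add_section (hS.smooth hX hY)
  swap p u v := by
    simp only [LinearMap.add_apply, hT.swap p u v, hS.swap p u v]
    abel
  inner_swap p u v w := by
    simp only [LinearMap.add_apply, inner_add_left, hT.inner_swap p u v w, hS.inner_swap p u v w]
    ring

theorem smul (a : ℝ) (hT : IsSmoothThreeForm T) : IsSmoothThreeForm fun x => a • T x where
  smooth hX hY := (hT.smooth hX hY).const_smul_section
  swap p u v := by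
    simp only [LinearMap.smul_apply, hT.swap p u v, smul_neg]
  inner_swap p u v w := by
    simp only [LinearMap.smul_apply, real_inner_smul_left, hT.inner_swap p u v w]
    ring

theorem zero : IsSmoothThreeForm
    (fun _ => 0 : Π x : M, TangentSpace I x →ₗ[ℝ] TangentSpace I x →ₗ[ℝ] TangentSpace I x) where
  smooth _ _ := contMDiff_zeroSection ℝ (TangentSpace I : M → Type _) _
  swap p u v := by simp
  inner_swap p u v w := by simp

theorem divergence_zero (p : M) (u v : TangentSpace I p) : divergence cov
    (fun _ => 0 : Π x : M, TangentSpace I x →ₗ[ℝ] TangentSpace I x →ₗ[ℝ] TangentSpace I x)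
      p u v = 0 := by
  have := divergence_smul (cov := cov) (u := u) (v := v) (T := fun _ => 0) 0
    (zero.mdiffAt u v)
  simpa using this

theorem sum {ι : Type*} (s : Finset ι)
    {F : ι → Π x : M, TangentSpace I x →ₗ[ℝ] TangentSpace I x →ₗ[ℝ] TangentSpace I x}
    (hF : ∀ i, IsSmoothThreeForm (F i)) :
    IsSmoothThreeForm (fun x => ∑ i ∈ s, F i x) ∧ ∀ (p : M) (u v : TangentSpace I p),
      divergence cov (fun x => ∑ i ∈ s, F i x) p u v = ∑ i ∈ s, divergence cov (F i) p u v := by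
  classical
  induction s using Finset.induction_on with
  | empty => simpa using ⟨zero, divergence_zero⟩
  | insert i s hi ih =>
    simp only [Finset.sum_insert hi]
    refine ⟨(hF i).add ih.1, fun p u v => ?_⟩
    rw [divergence_add ((hF i).mdiffAt u v) (ih.1.mdiffAt u v), ih.2]

end IsSmoothThreeForm

namespace IsThreeSasakian

variable {ξ : Fin 3 → Π x : M, TangentSpace I x} (h : IsThreeSasakian cov ξ)
  (hcov : IsLeviCivita cov)
include h hcov

theorem isSmoothThreeForm_torsionO : IsSmoothThreeForm (torsionO ξ) := by
  rw [torsionO_eq]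
  exact isSmoothThreeForm_torsionOf h.preservesSmooth_verticalRotation
    (isSkewField_verticalRotation ξ) (h.sasakian 0).smooth

theorem isSmoothThreeForm_torsionRS (r s : Fin 3) : IsSmoothThreeForm (torsionRS cov ξ r s) :=
  isSmoothThreeForm_torsionOf ((h.sasakian s).preservesSmooth hcov) (h.sasakian s).isSkewField
    (h.sasakian r).smooth

theorem isSmoothThreeForm_torsionAB_and_divergence_eq (a : ℝ) (B : Matrix (Fin 3) (Fin 3) ℝ) :
    IsSmoothThreeForm (torsionAB cov ξ a B) ∧ ∀ (p : M) (u v : TangentSpace I p),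
      divergence cov (torsionAB cov ξ a B) p u v =
        ∑ r, ∑ s, B r s * divergence cov (torsionRS cov ξ r s) p u v := by
  have hO := (h.isSmoothThreeForm_torsionO hcov)
  have hRS := h.isSmoothThreeForm_torsionRS hcov
  have h1 := fun r => IsSmoothThreeForm.sum (cov := cov) Finset.univ
    fun s => (hRS r s).smul (B r s)
  have h2 := IsSmoothThreeForm.sum (cov := cov) Finset.univ fun r => (h1 r).1
  refine ⟨(hO.smul a).add h2.1, fun p u v => ?_⟩
  refine (divergence_add ((hO.smul a).mdiffAt u v) (h2.1.mdiffAt u v)).trans ?_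
  rw [divergence_smul a (hO.mdiffAt u v), h.divergence_torsionO hcov p u v, h2.2, mul_zero,
    zero_add]
  refine Finset.sum_congr rfl fun r _ => ?_
  rw [(h1 r).2]
  refine Finset.sum_congr rfl fun s _ => ?_
  rw [divergence_smul _ ((hRS r s).mdiffAt u v)]

theorem isSmoothThreeForm_torsionAB (a : ℝ) (B : Matrix (Fin 3) (Fin 3) ℝ) :
    IsSmoothThreeForm (torsionAB cov ξ a B) := (h.isSmoothThreeForm_torsionAB_and_divergence_eq hcov a B).1

theorem divergence_torsionAB (a : ℝ) (B : Matrix (Fin 3) (Fin 3) ℝ) (p : M)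
    (u v : TangentSpace I p) :
    divergence cov (torsionAB cov ξ a B) p u v = ∑ r, (B r (r + 1) - B (r + 1) r) *
      (2 * PhiOf cov (ξ (r + 2)) p u v
        + ((Module.finrank ℝ E : ℝ) - 1)
          * wedge₁₁ (etaOf (ξ r) p) (etaOf (ξ (r + 1)) p) u v) := by
  have h0 := fun r => h.divergence_torsionRS_self hcov r p u v
  have h01 := h.divergence_torsionRS_next hcov 0 p u v
  have h12 := h.divergence_torsionRS_next hcov 1 p u v
  have h20 := h.divergence_torsionRS_next hcov 2 p u v
  have h02 := h.divergence_torsionRS_prev hcov 0 p u v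
  have h10 := h.divergence_torsionRS_prev hcov 1 p u v
  have h21 := h.divergence_torsionRS_prev hcov 2 p u v
  simp only [wedge₁₁_apply, zero_add, Fin.reduceAdd] at h01 h12 h20 h02 h10 h21
  rw [(h.isSmoothThreeForm_torsionAB_and_divergence_eq hcov a B).2]
  simp only [Fin.sum_univ_three, h0, h01, h12, h20, h02, h10, h21, wedge₁₁_apply, zero_add,
    Fin.reduceAdd]
  ring

/-- For a divergence-free `3`-form `S`, the tensor `a T^o + ∑ b_{rs} T^{rs} + S` is divergence-free
if and only if the matrix `(b_{rs})` is symmetric. -/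
theorem hasZeroDivergence_torsionAB_add_iff [Nonempty M] (hE : 3 < Module.finrank ℝ E)
    {S : Π x : M, TangentSpace I x →ₗ[ℝ] TangentSpace I x →ₗ[ℝ] TangentSpace I x}
    (hS : IsSmoothThreeForm S) (hS0 : HasZeroDivergence cov S) (a : ℝ)
    (B : Matrix (Fin 3) (Fin 3) ℝ) :
    HasZeroDivergence cov (fun x => torsionAB cov ξ a B x + S x) ↔ B.IsSymm := by
  have hE' : (3 : ℝ) < Module.finrank ℝ E := by exact_mod_cast hE
  have hdiv : ∀ (p : M) (u v : TangentSpace I p),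
      divergence cov (fun x => torsionAB cov ξ a B x + S x) p u v = 
        divergence cov (torsionAB cov ξ a B) p u v := fun p u v => by
    rw [divergence_add ((h.isSmoothThreeForm_torsionAB hcov a B).mdiffAt u v) (hS.mdiffAt u v),
      hS0 p u v, add_zero]
  constructor
  · intro h0
    obtain ⟨p⟩ := ‹Nonempty M›
    obtain ⟨h01, h12, h20, h10, h21, h02⟩ := h.phi_vertical hcov p
    have h0' := fun u v => (h.divergence_torsionAB hcov a B p u v).symm.trans
      ((hdiv p u v).symm.trans (h0 p u v))
    have e := h.inner_ne (r := 0) (s := 1) (by decide) p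
    have e' := h.inner_ne (r := 1) (s := 0) (by decide) p
    have f := h.inner_ne (r := 1) (s := 2) (by decide) p
    have f' := h.inner_ne (r := 2) (s := 1) (by decide) p
    have g := h.inner_ne (r := 2) (s := 0) (by decide) p
    have g' := h.inner_ne (r := 0) (s := 2) (by decide) p
    have k0 := h0' (ξ 0 p) (ξ 1 p)
    have k1 := h0' (ξ 1 p) (ξ 2 p)
    have k2 := h0' (ξ 2 p) (ξ 0 p)
    have hs := fun r => (h.sasakian r).phi_self hcov p
    simp only [Fin.sum_univ_three, wedge₁₁_apply, PhiOf, endoForm_apply, etaOf,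
      innerₗ_apply_apply, ContinuousLinearMap.coe_coe, zero_add, Fin.reduceAdd, h01, h12, h20, h10,
      h21, h02, hs, inner_neg_right, inner_zero_right, h.inner_self, e, e', f, f', g, g']
      at k0 k1 k2
    have hne : (-2 + ((Module.finrank ℝ E : ℝ) - 1)) ≠ 0 := by linarith
    have s01 : B 0 1 - B 1 0 = 0 := (mul_eq_zero.1 (by linarith)).resolve_right hne
    have s12 : B 1 2 - B 2 1 = 0 := (mul_eq_zero.1 (by linarith)).resolve_right hne
    have s20 : B 2 0 - B 0 2 = 0 := (mul_eq_zero.1 (by linarith)).resolve_right hne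
    ext i j
    rw [Matrix.transpose_apply]
    fin_cases i <;> fin_cases j <;> first | rfl | (simp; linarith)
  · intro hB p u v
    have hs : ∀ r, B r (r + 1) - B (r + 1) r = 0 := fun r => by
      rw [hB.apply, sub_self]
    rw [hdiv, h.divergence_torsionAB hcov]
    simp [hs]

/-- The three characterizations of the symmetry of `(b_{rs})`, for tensors
`a T^o + ∑ b_{rs} T^{rs} + S` with `S` a divergence-free `3`-form. -/
theorem torsionAB_add_iff [Nonempty M] (hE : 3 < Module.finrank ℝ E)
    {S : Π x : M, TangentSpace I x →ₗ[ℝ] TangentSpace I x →ₗ[ℝ] TangentSpace I x}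
    (hS : IsSmoothThreeForm S) (hS0 : HasZeroDivergence cov S) (a : ℝ)
    (B : Matrix (Fin 3) (Fin 3) ℝ) :
    (HasZeroDivergence cov (fun x => torsionAB cov ξ a B x + S x) ↔ B.IsSymm) ∧
    (HasSymmetricRicci (addTensor cov fun x => torsionAB cov ξ a B x + S x) ↔ B.IsSymm) ∧
    (HasSymmetricRicci (addTensor cov fun x => (1 / 2 : ℝ) • (torsionAB cov ξ a B x + S x))
      ↔ B.IsSymm) := by
  have hT := (h.isSmoothThreeForm_torsionAB hcov a B).add hS
  have h1 := h.hasZeroDivergence_torsionAB_add_iff hcov hE hS hS0 a B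
  refine ⟨h1, (hT.hasSymmetricRicci_iff hcov).trans h1,
    ((hT.smul (1 / 2)).hasSymmetricRicci_iff hcov).trans (Iff.trans ?_ h1)⟩
  refine forall_congr' fun p => forall_congr' fun u => forall_congr' fun v => ?_
  rw [divergence_smul _ (hT.mdiffAt u v)]
  simp

end IsThreeSasakian

end Sasakian

theorem ContinuousLinearMap.isInvertible_of_injective {E : Type*} [NormedAddCommGroup E]
    [NormedSpace ℝ E] [FiniteDimensional ℝ E] {L : E →L[ℝ] E} (hL : Function.Injective L) :
    L.IsInvertible :=
  ⟨(LinearEquiv.ofInjectiveEndo (L : E →ₗ[ℝ] E) hL).toContinuousLinearEquiv, by ext; rfl⟩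

section Naturality

variable {E : Type*} [NormedAddCommGroup E] [NormedSpace ℝ E] [FiniteDimensional ℝ E]
  {H : Type*} [TopologicalSpace H] {I : ModelWithCorners ℝ E H}
  {M : Type*} [TopologicalSpace M] [ChartedSpace H M] [IsManifold I ∞ M] [T2Space M]
  [RiemannianBundle (fun x : M => TangentSpace I x)]
  [IsContMDiffRiemannianBundle I ∞ E (fun x : M => TangentSpace I x)]
  {cov : CovariantDerivative I E (TangentSpace I : M → Type _)}

theorem IsLeviCivita.koszul (hcov : IsLeviCivita cov) {X Y Z : Π x : M, TangentSpace I x} {p : M}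
    (hX : MDiffAt (T% X) p) (hY : MDiffAt (T% Y) p) (hZ : MDiffAt (T% Z) p) :
    2 * ⟪cov Y p (X p), Z p⟫_ℝ =
      d% (fun y => ⟪Y y, Z y⟫_ℝ) p (X p) + d% (fun y => ⟪X y, Z y⟫_ℝ) p (Y p)
      - d% (fun y => ⟪X y, Y y⟫_ℝ) p (Z p) + ⟪mlieBracket I X Y p, Z p⟫_ℝ
      - ⟪mlieBracket I X Z p, Y p⟫_ℝ - ⟪mlieBracket I Y Z p, X p⟫_ℝ := by
  rw [hcov.metric Y Z p _ hY hZ, hcov.metric X Z p _ hX hZ, hcov.metric X Y p _ hX hY,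
    hcov.mlieBracket_eq hX hY, hcov.mlieBracket_eq hX hZ, hcov.mlieBracket_eq hY hZ]
  simp only [inner_sub_left]
  rw [real_inner_comm (cov Z p (X p)) (Y p), real_inner_comm (cov Z p (Y p)) (X p),
    real_inner_comm (cov Y p (Z p)) (X p)]
  ring

/-- The map `f` is smooth and preserves the Riemannian metric. -/
structure IsSmoothIsometry (I : ModelWithCorners ℝ E H) [IsManifold I ∞ M]
    [RiemannianBundle (fun x : M => TangentSpace I x)] (f : M → M) : Prop where
  smooth : CMDiff ∞ f
  inner_map : ∀ (p : M) (u v : TangentSpace I p),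
    ⟪mfderiv I I f p u, mfderiv I I f p v⟫_ℝ = ⟪u, v⟫_ℝ

namespace IsSmoothIsometry

variable {f : M → M} (hf : IsSmoothIsometry I f)
include hf

theorem injective (p : M) : Function.Injective (mfderiv I I f p) := by
  refine (injective_iff_map_eq_zero _).2 fun u hu => ?_
  have := hf.inner_map p u u
  rw [hu, inner_zero_left] at this
  exact inner_self_eq_zero.1 this.symm

theorem isInvertible (p : M) : (mfderiv I I f p).IsInvertible :=
  ContinuousLinearMap.isInvertible_of_injective (E := E) (L := mfderiv I I f p) (hf.injective p)

theorem map_mpullback (X : Π x : M, TangentSpace I x) (p : M) :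
    mfderiv I I f p (mpullback I I f X p) = X (f p) :=
  (hf.isInvertible p).self_apply_inverse _

theorem mpullback_map {X : Π x : M, TangentSpace I x} {p : M} {u : TangentSpace I p}
    (h : mfderiv I I f p u = X (f p)) : mpullback I I f X p = u := by
  rw [mpullback_apply, ← h]
  exact (hf.isInvertible p).inverse_apply_self _

theorem mdiffAt_mpullback {X : Π x : M, TangentSpace I x} {p : M} (hX : MDiffAt (T% X) (f p)) :
    MDiffAt (T% (mpullback I I f X)) p := by
  have : IsManifold I 2 M := .of_le (n := ∞) (WithTop.coe_le_coe.2 le_top)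
  have : IsManifold I 1 M := .of_le (n := ∞) (WithTop.coe_le_coe.2 le_top)
  have : CompleteSpace E := FiniteDimensional.complete ℝ E
  exact hX.mpullback_vectorField (hf.smooth p) (hf.isInvertible p)
    (WithTop.coe_le_coe.2 le_top)

theorem inner_mpullback (X Y : Π x : M, TangentSpace I x) (p : M) :
    ⟪mpullback I I f X p, mpullback I I f Y p⟫_ℝ = ⟪X (f p), Y (f p)⟫_ℝ := by
  rw [← hf.inner_map, hf.map_mpullback, hf.map_mpullback]

theorem mvfderiv_inner_mpullback {X Y Z : Π x : M, TangentSpace I x} {p : M}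
    (hX : MDiffAt (T% X) (f p)) (hY : MDiffAt (T% Y) (f p)) :
    d% (fun y => ⟪mpullback I I f X y, mpullback I I f Y y⟫_ℝ) p (mpullback I I f Z p)
      = d% (fun y => ⟪X y, Y y⟫_ℝ) (f p) (Z (f p)) := by
  have e : (fun y => ⟪mpullback I I f X y, mpullback I I f Y y⟫_ℝ)
      = (fun y => ⟪X y, Y y⟫_ℝ) ∘ f := by
    funext y; exact hf.inner_mpullback X Y y
  have : IsContMDiffRiemannianBundle I 1 E (fun x : M => TangentSpace I x) :=
    IsContMDiffRiemannianBundle.of_le (IB := I) (n := ∞) (WithTop.coe_le_coe.2 le_top)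
  have hd : MDiffAt (fun y => ⟪X y, Y y⟫_ℝ) (f p) :=
    MDifferentiableAt.inner_bundle (E := fun x : M => TangentSpace I x) (b := id) hX hY
  rw [e, mvfderiv_comp_apply _ hd ((hf.smooth p).mdifferentiableAt (by simp)), hf.map_mpullback]

theorem inner_mlieBracket_mpullback {X Y Z : Π x : M, TangentSpace I x} {p : M}
    (hX : MDiffAt (T% X) (f p)) (hY : MDiffAt (T% Y) (f p)) :
    ⟪mlieBracket I (mpullback I I f X) (mpullback I I f Y) p, mpullback I I f Z p⟫_ℝ
      = ⟪mlieBracket I X Y (f p), Z (f p)⟫_ℝ := by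
  have : IsManifold I (minSmoothness ℝ 3) M := isManifold_minSmoothness 3
  have : CompleteSpace E := FiniteDimensional.complete ℝ E
  rw [← mpullback_mlieBracket hX hY (hf.smooth p) (by
    simp only [minSmoothness_of_isRCLikeNormedField]
    exact WithTop.coe_le_coe.2 le_top), hf.inner_mpullback]

/-- The Levi-Civita connection is preserved by isometries. -/
theorem map_cov (hcov : IsLeviCivita cov) {Y : Π x : M, TangentSpace I x} {p : M}
    (hY : MDiffAt (T% Y) (f p)) (w : TangentSpace I p) :
    mfderiv I I f p (cov (mpullback I I f Y) p w) = cov Y (f p) (mfderiv I I f p w) := by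
  refine ext_inner_right ℝ fun z => ?_
  set X : Π x : M, TangentSpace I x := FiberBundle.extend E (mfderiv I I f p w) with hXd
  set Z : Π x : M, TangentSpace I x := FiberBundle.extend E z with hZd
  have hX : MDiffAt (T% X) (f p) := (SmoothNear.extend _).mdiffAt
  have hZ : MDiffAt (T% Z) (f p) := (SmoothNear.extend _).mdiffAt
  have hXp : X (f p) = mfderiv I I f p w := by simp [hXd]
  have hZp : Z (f p) = z := by simp [hZd]
  have hw : mpullback I I f X p = w := hf.mpullback_map hXp.symm
  rw [← hXp, ← hZp, ← hf.map_mpullback Z, hf.inner_map, hf.map_mpullback]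
  have k1 := hcov.koszul hX hY hZ
  have k2 := hcov.koszul (hf.mdiffAt_mpullback hX) (hf.mdiffAt_mpullback hY)
    (hf.mdiffAt_mpullback hZ)
  rw [hf.mvfderiv_inner_mpullback hY hZ, hf.mvfderiv_inner_mpullback hX hZ,
    hf.mvfderiv_inner_mpullback hX hY, hf.inner_mlieBracket_mpullback hX hY,
    hf.inner_mlieBracket_mpullback hX hZ, hf.inner_mlieBracket_mpullback hY hZ, hw] at k2
  linarith

end IsSmoothIsometry

/-- The field of endomorphisms `φ` maps differentiable vector fields to differentiable vector
fields. -/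
def PreservesMDiff (φ : Π x : M, TangentSpace I x →L[ℝ] TangentSpace I x) : Prop :=
  ∀ ⦃X : Π x : M, TangentSpace I x⦄ ⦃p : M⦄, MDiffAt (T% X) p →
    MDiffAt (T% (fun q => φ q (X q))) p

variable {φ : Π x : M, TangentSpace I x →L[ℝ] TangentSpace I x}

theorem endoDeriv_apply_section (hφ : PreservesMDiff φ) {V : Π x : M, TangentSpace I x} {p : M}
    (hV : MDiffAt (T% V) p) (w : TangentSpace I p) :
    cov (fun q => φ q (V q)) p w - φ p (cov V p w) = endoDeriv cov φ p (V p) w := by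
  have ht : TensorialAt I E (V := fun x : M => TangentSpace I x)
      (fun V => cov (fun q => φ q (V q)) p w - φ p (cov V p w)) p := by
    refine ⟨fun {g σ} hg hσ => ?_, fun {σ σ'} hσ hσ' => ?_⟩
    · have e : (fun q => φ q ((g • σ) q)) = g • fun q => φ q (σ q) := by
        funext q; simp
      simp only [e]
      rw [cov.leibniz_apply hg (hφ hσ), cov.leibniz_apply hg hσ, map_add, map_smul, map_smul]
      module
    · have e : (fun q => φ q ((σ + σ') q)) = (fun q => φ q (σ q)) + fun q => φ q (σ' q) := by
        funext q; simp
      simp only [e]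
      rw [cov.add_apply (hφ hσ) (hφ hσ'), cov.add_apply hσ hσ', map_add]
      abel
  exact ht.pointwise hV (SmoothNear.extend (V p)).mdiffAt (by simp)

theorem endoDeriv_add (hφ : PreservesMDiff φ) {p : M} (u v : TangentSpace I p) :
    endoDeriv cov φ p (u + v) = endoDeriv cov φ p u + endoDeriv cov φ p v := by
  ext w
  have hu : MDiffAt (T% (FiberBundle.extend E u)) p := (SmoothNear.extend u).mdiffAt
  have hv : MDiffAt (T% (FiberBundle.extend E v)) p := (SmoothNear.extend v).mdiffAt
  have := endoDeriv_apply_section (cov := cov) hφ (mdifferentiableAt_add_section hu hv) w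
  have e : (fun q => φ q (((FiberBundle.extend E u : Π x : M, TangentSpace I x)
      + FiberBundle.extend E v) q)) = (fun q => φ q (FiberBundle.extend E u q))
        + fun q => φ q (FiberBundle.extend E v q) := by
    funext q; simp
  rw [e, cov.add_apply (hφ hu) (hφ hv), cov.add_apply hu hv, map_add] at this
  simp only [Pi.add_apply, FiberBundle.extend_apply_self] at this
  rw [LinearMap.add_apply, ← this, endoDeriv_apply, endoDeriv_apply]
  abel

theorem endoDeriv_smul (hφ : PreservesMDiff φ) {p : M} (a : ℝ) (u : TangentSpace I p) :
    endoDeriv cov φ p (a • u) = a • endoDeriv cov φ p u := by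
  ext w
  have hu : MDiffAt (T% (FiberBundle.extend E u)) p := (SmoothNear.extend u).mdiffAt
  have hau : MDiffAt (T% (a • FiberBundle.extend E u : Π x : M, TangentSpace I x)) p :=
    (mdifferentiableAt_const (c := a)).smul_section hu
  have := endoDeriv_apply_section (cov := cov) hφ hau w
  have e : (fun q => φ q ((a • FiberBundle.extend E u : Π x : M, TangentSpace I x) q))
      = a • fun q => φ q (FiberBundle.extend E u q) := by
    funext q; simp
  rw [e, cov.smul_apply a (hφ hu), cov.smul_apply a hu, map_smul] at this
  simp only [Pi.smul_apply, FiberBundle.extend_apply_self] at this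
  rw [LinearMap.smul_apply, ← this, endoDeriv_apply]
  module

/-- The covariant derivative of an invariant field of endomorphisms is invariant. -/
theorem IsSmoothIsometry.map_endoDeriv {f : M → M} (hf : IsSmoothIsometry I f)
    (hcov : IsLeviCivita cov) (hφ : PreservesMDiff φ)
    (hfφ : ∀ (p : M) (u : TangentSpace I p),
      mfderiv I I f p (φ p u) = φ (f p) (mfderiv I I f p u)) {p : M} (v w : TangentSpace I p) :
    mfderiv I I f p (endoDeriv cov φ p v w)
      = endoDeriv cov φ (f p) (mfderiv I I f p v) (mfderiv I I f p w) := by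
  set V : Π x : M, TangentSpace I x := FiberBundle.extend E (mfderiv I I f p v) with hVd
  have hV : MDiffAt (T% V) (f p) := (SmoothNear.extend _).mdiffAt
  have hVp : V (f p) = mfderiv I I f p v := by simp [hVd]
  have hv : mpullback I I f V p = v := hf.mpullback_map hVp.symm
  have e : (fun q => φ q (mpullback I I f V q)) = mpullback I I f fun q => φ q (V q) := by
    funext q
    refine (hf.mpullback_map ?_).symm
    rw [hfφ, hf.map_mpullback]
  rw [← hVp, ← endoDeriv_apply_section hφ hV, ← hf.map_cov hcov (hφ hV), ← hf.map_cov hcov hV,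
    ← hfφ, ← map_sub, ← e, endoDeriv_apply_section hφ (hf.mdiffAt_mpullback hV), hv]

end Naturality

section Rotation

variable {E : Type*} [NormedAddCommGroup E] [NormedSpace ℝ E] [FiniteDimensional ℝ E]
  {H : Type*} [TopologicalSpace H] {I : ModelWithCorners ℝ E H}
  {M : Type*} [TopologicalSpace M] [ChartedSpace H M] [IsManifold I ∞ M]
  [RiemannianBundle (fun x : M => TangentSpace I x)]
  {cov : CovariantDerivative I E (TangentSpace I : M → Type _)}

/-- The endomorphism `J = φ₀ + ∑ₛ ηₛ ⊗ ξₛ` of the tangent space. -/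
def tangentRotation (ξ : Fin 3 → Π x : M, TangentSpace I x)
    (φ₀ : Π x : M, TangentSpace I x →L[ℝ] TangentSpace I x) (x : M) :
    TangentSpace I x →ₗ[ℝ] TangentSpace I x :=
  (φ₀ x : TangentSpace I x →ₗ[ℝ] TangentSpace I x)
    + ∑ s, (innerₗ (TangentSpace I x) (ξ s x)).smulRight (ξ s x)

theorem tangentRotation_apply (ξ : Fin 3 → Π x : M, TangentSpace I x)
    (φ₀ : Π x : M, TangentSpace I x →L[ℝ] TangentSpace I x) (x : M) (u : TangentSpace I x) :
    tangentRotation ξ φ₀ x u = φ₀ x u + ∑ s, ⟪ξ s x, u⟫_ℝ • ξ s x := by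
  simp [tangentRotation]

/-- At each point `p`, the endomorphism `φ₀ + ∑ₛ ηₛ ⊗ ξₛ` is the derivative of a smooth isometry
that fixes `p` and preserves the fields `ξ r` and `φ₀`; it squares to `-1` on the orthogonal
complement of the span of the `ξ r`. -/
structure HasRotations (ξ : Fin 3 → Π x : M, TangentSpace I x)
    (φ₀ : Π x : M, TangentSpace I x →L[ℝ] TangentSpace I x) : Prop where
  preservesSmooth : PreservesSmooth φ₀
  preservesMDiff : PreservesMDiff φ₀
  sq : ∀ (x : M) (u : TangentSpace I x), φ₀ x (φ₀ x u) = -u + ∑ s, ⟪ξ s x, u⟫_ℝ • ξ s x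
  rotation : ∀ p : M, ∃ f : M → M, IsSmoothIsometry I f ∧ f p = p ∧
    (∀ r q, mfderiv I I f q (ξ r q) = ξ r (f q)) ∧
    (∀ q u, mfderiv I I f q (φ₀ q u) = φ₀ (f q) (mfderiv I I f q u)) ∧
    ∀ u : TangentSpace I p, (mfderiv I I f p u : E) = tangentRotation ξ φ₀ p u

variable [T2Space M] [IsContMDiffRiemannianBundle I ∞ E (fun x : M => TangentSpace I x)]
  {ξ : Fin 3 → Π x : M, TangentSpace I x}
  {φ₀ : Π x : M, TangentSpace I x →L[ℝ] TangentSpace I x}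

theorem IsSmoothIsometry.map_phiOf {f : M → M} (hf : IsSmoothIsometry I f)
    (hcov : IsLeviCivita cov) {ζ : Π x : M, TangentSpace I x} (hζ : IsSasakian cov ζ)
    (hfζ : ∀ q, mfderiv I I f q (ζ q) = ζ (f q)) (p : M) (u : TangentSpace I p) :
    mfderiv I I f p (phiOf cov ζ p u) = phiOf cov ζ (f p) (mfderiv I I f p u) := by
  have e : mpullback I I f ζ = ζ := funext fun q => hf.mpullback_map (hfζ q)
  have := hf.map_cov hcov (hζ.smoothNear (f p)).mdiffAt u
  rw [e] at this
  rw [phiOf_apply, phiOf_apply, map_neg, this]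

namespace HasRotations

section Pointwise

variable (h : HasRotations ξ φ₀)
include h

theorem inner_tangentRotation (p : M) (u v : TangentSpace I p) :
    ⟪tangentRotation ξ φ₀ p u, tangentRotation ξ φ₀ p v⟫_ℝ = ⟪u, v⟫_ℝ := by
  obtain ⟨f, hf, hfp, -, -, hJ⟩ := h.rotation p
  have key : ∀ q, f p = q → ∀ u v : TangentSpace I p,
      ⟪(show TangentSpace I q from mfderiv I I f p u),
        (show TangentSpace I q from mfderiv I I f p v)⟫_ℝ = ⟪u, v⟫_ℝ := by
    rintro _ rfl u v
    exact hf.inner_map p u v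
  have := key p hfp u v
  rwa [show mfderiv I I f p u = _ from hJ u, show mfderiv I I f p v = _ from hJ v] at this

theorem tangentRotation_reeb (r : Fin 3) (p : M) : tangentRotation ξ φ₀ p (ξ r p) = ξ r p := by
  obtain ⟨f, hf, hfp, hξ, -, hJ⟩ := h.rotation p
  have key : ∀ q, f p = q → (mfderiv I I f p (ξ r p) : E) = ξ r q := by
    rintro _ rfl
    exact hξ r p
  exact (hJ _).symm.trans (key p hfp)

theorem tangentRotation_phi (hcov : IsLeviCivita cov) (hξ : IsThreeSasakian cov ξ) (r : Fin 3)
    (p : M) (u : TangentSpace I p) :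
    tangentRotation ξ φ₀ p (phiOf cov (ξ r) p u) =
      phiOf cov (ξ r) p (tangentRotation ξ φ₀ p u) := by
  obtain ⟨f, hf, hfp, hfξ, -, hJ⟩ := h.rotation p
  have key : ∀ q, f p = q → (mfderiv I I f p (phiOf cov (ξ r) p u) : E)
      = phiOf cov (ξ r) q (show TangentSpace I q from mfderiv I I f p u) := by
    rintro _ rfl
    exact hf.map_phiOf hcov (hξ.sasakian r) (hfξ r) p u
  have := key p hfp
  rw [show mfderiv I I f p u = _ from hJ u] at this
  exact (hJ _).symm.trans this

theorem tangentRotation_endoDeriv (hcov : IsLeviCivita cov) (p : M) (v w : TangentSpace I p) :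
    tangentRotation ξ φ₀ p (endoDeriv cov φ₀ p v w) =
      endoDeriv cov φ₀ p (tangentRotation ξ φ₀ p v) (tangentRotation ξ φ₀ p w) := by
  obtain ⟨f, hf, hfp, -, hfφ, hJ⟩ := h.rotation p
  have key : ∀ q, f p = q → (mfderiv I I f p (endoDeriv cov φ₀ p v w) : E)
      = endoDeriv cov φ₀ q (show TangentSpace I q from mfderiv I I f p v)
          (show TangentSpace I q from mfderiv I I f p w) := by
    rintro _ rfl
    exact hf.map_endoDeriv hcov h.preservesMDiff hfφ v w
  have := key p hfp
  rw [show mfderiv I I f p v = _ from hJ v, show mfderiv I I f p w = _ from hJ w] at this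
  exact (hJ _).symm.trans this

variable (ho : ∀ x, Orthonormal ℝ fun r => ξ r x)
include ho

theorem apply_reeb (r : Fin 3) (p : M) : φ₀ p (ξ r p) = 0 := by
  have h1 := h.tangentRotation_reeb r p
  rw [tangentRotation_apply] at h1
  have : ∑ s, ⟪ξ s p, ξ r p⟫_ℝ • ξ s p = ξ r p := by
    simp [orthonormal_iff_ite.1 (ho p)]
  rw [this] at h1
  simpa using h1

theorem inner_reeb_apply (r : Fin 3) (p : M) (u : TangentSpace I p) :
    ⟪ξ r p, φ₀ p u⟫_ℝ = 0 := by
  have h1 := h.inner_tangentRotation p (ξ r p) u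
  rw [h.tangentRotation_reeb, tangentRotation_apply, inner_add_right, inner_sum] at h1
  simp only [real_inner_smul_right, orthonormal_iff_ite.1 (ho p)] at h1
  simpa using h1

theorem isSkewField : IsSkewField φ₀ := by
  intro p u v
  have h1 := h.inner_tangentRotation p u (φ₀ p v)
  have h2 : ∀ s, ⟪φ₀ p u, ξ s p⟫_ℝ = 0 := fun s => by
    rw [real_inner_comm]; exact h.inner_reeb_apply ho s p u
  rw [tangentRotation_apply, tangentRotation_apply, inner_add_left, h.sq] at h1
  simp only [h.inner_reeb_apply ho, zero_smul, Finset.sum_const_zero, add_zero, inner_add_right,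
    inner_neg_right, sum_inner, inner_sum, real_inner_smul_left, real_inner_smul_right, h2,
    mul_zero, orthonormal_iff_ite.1 (ho p)] at h1
  simp [Fin.sum_univ_three] at h1
  linarith

theorem phi_comm (hcov : IsLeviCivita cov) (hξ : IsThreeSasakian cov ξ) (r : Fin 3)
    (p : M) (u : TangentSpace I p) :
    φ₀ p (phiOf cov (ξ r) p u) = phiOf cov (ξ r) p (φ₀ p u) := by
  have h1 := h.tangentRotation_phi hcov hξ r p u
  rw [tangentRotation_apply, tangentRotation_apply, map_add, map_sum] at h1
  have h2 : ∀ s, ⟪ξ s p, phiOf cov (ξ r) p u⟫_ℝ = -⟪phiOf cov (ξ r) p (ξ s p), u⟫_ℝ := fun s => by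
    rw [(hξ.sasakian r).isSkewField, neg_neg]
  obtain ⟨h01, h12, h20, h10, h21, h02⟩ := hξ.phi_vertical hcov p
  have h00 := fun r => (hξ.sasakian r).phi_self hcov p
  have h3 : ∑ s, ⟪ξ s p, phiOf cov (ξ r) p u⟫_ℝ • ξ s p
      = ∑ s, phiOf cov (ξ r) p (⟪ξ s p, u⟫_ℝ • ξ s p) := by
    simp only [map_smul, h2]
    fin_cases r <;>
      simp [Fin.sum_univ_three, h01, h12, h20, h10, h21, h02, h00, inner_neg_left]
  rw [h3] at h1
  exact add_right_cancel h1

theorem endoDeriv_reeb (hξ : IsThreeSasakian cov ξ) (r : Fin 3) (p : M) (w : TangentSpace I p) :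
    endoDeriv cov φ₀ p (ξ r p) w = φ₀ p (phiOf cov (ξ r) p w) := by
  have h1 := endoDeriv_apply_section (cov := cov) h.preservesMDiff
    ((hξ.sasakian r).smoothNear p).mdiffAt w
  have h2 : (fun q => φ₀ q (ξ r q)) = (0 : Π x : M, TangentSpace I x) :=
    funext fun q => h.apply_reeb ho r q
  rw [← h1, h2, cov.zero, phiOf_apply, map_neg]
  simp

theorem endoDeriv_apply_apply (hcov : IsLeviCivita cov) (hξ : IsThreeSasakian cov ξ)
    (p : M) (v w : TangentSpace I p) :
    endoDeriv cov φ₀ p (φ₀ p v) w + φ₀ p (endoDeriv cov φ₀ p v w) =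
      ∑ s, (⟪cov (ξ s) p w, v⟫_ℝ • ξ s p + ⟪ξ s p, v⟫_ℝ • cov (ξ s) p w) := by
  set V : Π x : M, TangentSpace I x := FiberBundle.extend E v with hVd
  have hV : SmoothNear V p := SmoothNear.extend v
  have hVp : V p = v := by simp [hVd]
  have h1 := endoDeriv_apply_section (cov := cov) h.preservesMDiff
    (h.preservesMDiff hV.mdiffAt) w
  have e : (fun q => φ₀ q (φ₀ q (V q))) = (((((-1 : ℝ) • V)
      + (fun q => ⟪ξ 0 q, V q⟫_ℝ) • ξ 0) + (fun q => ⟪ξ 1 q, V q⟫_ℝ) • ξ 1)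
      + (fun q => ⟪ξ 2 q, V q⟫_ℝ) • ξ 2 : Π x : M, TangentSpace I x) := by
    funext q
    rw [h.sq]
    simp [Fin.sum_univ_three, add_assoc]
  have hs := fun s => (hξ.sasakian s).smoothNear p
  have d := fun s => (hs s).inner_mdiffAt hV
  have m := fun s => (d s).smul_section (hs s).mdiffAt
  have m0 : MDiffAt (T% ((-1 : ℝ) • V)) p :=
    (mdifferentiableAt_const (c := (-1 : ℝ))).smul_section hV.mdiffAt
  have m1 := mdifferentiableAt_add_section m0 (m 0)
  have m2 := mdifferentiableAt_add_section m1 (m 1)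
  rw [e, cov.add_apply m2 (m 2), cov.add_apply m1 (m 1), cov.add_apply m0 (m 0),
    cov.smul_apply _ hV.mdiffAt, cov.leibniz_apply (d 0) (hs 0).mdiffAt,
    cov.leibniz_apply (d 1) (hs 1).mdiffAt, cov.leibniz_apply (d 2) (hs 2).mdiffAt,
    hcov.metric _ _ _ _ (hs 0).mdiffAt hV.mdiffAt, hcov.metric _ _ _ _ (hs 1).mdiffAt hV.mdiffAt,
    hcov.metric _ _ _ _ (hs 2).mdiffAt hV.mdiffAt, hVp] at h1
  have h2 : φ₀ p (cov (fun q => φ₀ q (V q)) p w)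
      = φ₀ p (endoDeriv cov φ₀ p v w) + φ₀ p (φ₀ p (cov V p w)) := by
    rw [← map_add, endoDeriv_apply, ← hVd, sub_add_cancel]
  rw [← h1, h2, h.sq]
  simp only [Fin.sum_univ_three]
  module

theorem endoDeriv_apply_reeb (hcov : IsLeviCivita cov) (hξ : IsThreeSasakian cov ξ) (r : Fin 3)
    (p : M) (v : TangentSpace I p) : endoDeriv cov φ₀ p v (ξ r p) = 0 := by
  obtain ⟨h01, h12, h20, h10, h21, h02⟩ := hξ.phi_vertical hcov p
  have h00 := fun r => (hξ.sasakian r).phi_self hcov p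
  have h1 := h.endoDeriv_apply_apply ho hcov hξ p v (ξ r p)
  have h2 : ∑ s, (⟪cov (ξ s) p (ξ r p), v⟫_ℝ • ξ s p + ⟪ξ s p, v⟫_ℝ • cov (ξ s) p (ξ r p))
      = 0 := by
    simp only [covariantDeriv_eq_neg_phiOf]
    fin_cases r <;>
      simp [Fin.sum_univ_three, h01, h12, h20, h10, h21, h02, h00, inner_neg_left]
  rw [h2] at h1
  have h3 := h.tangentRotation_endoDeriv hcov p v (ξ r p)
  rw [h.tangentRotation_reeb, tangentRotation_apply, tangentRotation_apply,
    endoDeriv_add h.preservesMDiff, LinearMap.add_apply] at h3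
  have h4 : endoDeriv cov φ₀ p (∑ s, ⟪ξ s p, v⟫_ℝ • ξ s p) (ξ r p) = 0 := by
    simp only [Fin.sum_univ_three, endoDeriv_add h.preservesMDiff,
      endoDeriv_smul h.preservesMDiff, LinearMap.add_apply, LinearMap.smul_apply,
      h.endoDeriv_reeb ho hξ, h.phi_comm ho hcov hξ, h.apply_reeb ho]
    simp
  rw [h4, add_zero] at h3
  set P := endoDeriv cov φ₀ p v (ξ r p)
  have h5 : (2 : ℝ) • φ₀ p P + ∑ s, ⟪ξ s p, P⟫_ℝ • ξ s p = 0 := by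
    rw [← h1, ← h3]
    module
  have h6 : φ₀ p (φ₀ p P) = 0 := by
    have := congrArg (φ₀ p) h5
    simp only [map_add, map_sum, map_smul, h.apply_reeb ho, smul_zero, Finset.sum_const_zero,
      add_zero, map_zero] at this
    exact (smul_eq_zero.1 this).resolve_left two_ne_zero
  have h7 : φ₀ p P = 0 := by
    have h8 := h6
    rw [h.sq, neg_add_eq_zero] at h8
    rw [h8, map_sum]
    simp only [map_smul, h.apply_reeb ho, smul_zero, Finset.sum_const_zero]
  rw [h.sq, neg_add_eq_zero] at h6
  rw [h7, smul_zero, zero_add] at h5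
  rw [h6, h5]

theorem trace_comp_phi (hcov : IsLeviCivita cov) (hξ : IsThreeSasakian cov ξ) (r : Fin 3)
    (p : M) : LinearMap.trace ℝ _ ((φ₀ p : TangentSpace I p →ₗ[ℝ] TangentSpace I p) ∘ₗ
      (phiOf cov (ξ (r + 2)) p : TangentSpace I p →ₗ[ℝ] TangentSpace I p)) = 0 := by
  set A := (φ₀ p : TangentSpace I p →ₗ[ℝ] TangentSpace I p)
  set F := fun r => (phiOf cov (ξ r) p : TangentSpace I p →ₗ[ℝ] TangentSpace I p)
  have h1 : A ∘ₗ F (r + 2) = (A ∘ₗ F r) ∘ₗ F (r + 1) := by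
    ext w
    have := congrArg (φ₀ p) (hξ.phi_phi hcov r p w)
    rw [map_add, map_smul, h.apply_reeb ho, smul_zero, add_zero] at this
    exact this.symm
  have h2 : A ∘ₗ F (r + 2) = -((A ∘ₗ F (r + 1)) ∘ₗ F r) := by
    ext w
    have := congrArg (φ₀ p) (hξ.phi_phi' hcov r p w)
    rw [map_add, map_smul, h.apply_reeb ho, smul_zero, add_zero, map_neg] at this
    exact (neg_eq_iff_eq_neg.2 this).symm
  have h3 : A ∘ₗ F r = F r ∘ₗ A := by
    ext w
    exact h.phi_comm ho hcov hξ r p w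
  have h4 : LinearMap.trace ℝ _ (A ∘ₗ F (r + 2)) = -LinearMap.trace ℝ _ (A ∘ₗ F (r + 2)) := by
    conv_lhs => rw [h1, h3, LinearMap.comp_assoc, LinearMap.trace_comp_comm']
    conv_rhs => rw [h2, map_neg, neg_neg]
  linarith

theorem trace_endoDeriv (hcov : IsLeviCivita cov) (hξ : IsThreeSasakian cov ξ)
    (p : M) (v : TangentSpace I p) : LinearMap.trace ℝ _ (endoDeriv cov φ₀ p v) = 0 := by
  have hreeb : ∀ r, LinearMap.trace ℝ _ (endoDeriv cov φ₀ p (ξ r p)) = 0 := by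
    intro r
    obtain ⟨s, rfl⟩ : ∃ s : Fin 3, r = s + 2 := ⟨r + 1, by fin_cases r <;> rfl⟩
    rw [← h.trace_comp_phi ho hcov hξ s p]
    congr 1
    ext w
    exact h.endoDeriv_reeb ho hξ _ p w
  have hinj : Function.Injective (tangentRotation ξ φ₀ p) := by
    refine (injective_iff_map_eq_zero _).2 fun u hu => ?_
    have := h.inner_tangentRotation p u u
    rw [hu, inner_zero_left] at this
    exact inner_self_eq_zero.1 this.symm
  set e := LinearEquiv.ofInjectiveEndo (tangentRotation ξ φ₀ p) hinj
  have hrot : ∀ v, LinearMap.trace ℝ _ (endoDeriv cov φ₀ p (tangentRotation ξ φ₀ p v))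
      = LinearMap.trace ℝ _ (endoDeriv cov φ₀ p v) := by
    intro v
    rw [← LinearMap.trace_conj' (endoDeriv cov φ₀ p v) e]
    congr 1
    ext w
    obtain ⟨z, rfl⟩ := e.surjective w
    rw [LinearEquiv.conj_apply_apply, LinearEquiv.symm_apply_apply]
    exact (h.tangentRotation_endoDeriv hcov p v z).symm
  have hφ : ∀ v, LinearMap.trace ℝ _ (endoDeriv cov φ₀ p (φ₀ p v))
      = LinearMap.trace ℝ _ (endoDeriv cov φ₀ p v) := by
    intro v
    rw [← hrot v, tangentRotation_apply]
    simp only [Fin.sum_univ_three, endoDeriv_add h.preservesMDiff,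
      endoDeriv_smul h.preservesMDiff, map_add, map_smul, hreeb, smul_zero, add_zero]
  have h1 := hφ (φ₀ p v)
  rw [h.sq, hφ, ← neg_one_smul ℝ v] at h1
  simp only [Fin.sum_univ_three, endoDeriv_add h.preservesMDiff,
      endoDeriv_smul h.preservesMDiff, map_add, map_smul, hreeb, smul_zero, add_zero] at h1
  simp only [smul_eq_mul] at h1
  linarith

/-- The tensor metrically equivalent to `ηᵣ ∧ Φ₀` is divergence-free. -/
theorem hasZeroDivergence_torsionOf (hcov : IsLeviCivita cov) (hξ : IsThreeSasakian cov ξ)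
    (r : Fin 3) : HasZeroDivergence cov (torsionOf (ξ r) φ₀) := by
  intro p u v
  rw [divergence_torsionOf hcov h.preservesSmooth (h.isSkewField ho) (hξ.sasakian r).smooth p
    ((hξ.sasakian r).killing p), h.trace_endoDeriv ho hcov hξ, h.trace_endoDeriv ho hcov hξ,
    h.endoDeriv_apply_reeb ho hcov hξ, inner_zero_right, covariantDeriv_eq_neg_phiOf,
    covariantDeriv_eq_neg_phiOf, inner_neg_left, inner_neg_left,
    (hξ.sasakian r).isSkewField, real_inner_comm (φ₀ p u), h.isSkewField ho,
    h.phi_comm ho hcov hξ]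
  ring

end Pointwise

end HasRotations
end Rotation

section Exponential

variable {m : ℕ}

section Norm

attribute [local instance] Matrix.linftyOpNormedRing Matrix.linftyOpNormedAlgebra

theorem contDiff_exp_matrix_apply {V : Type*} [NormedAddCommGroup V] [NormedSpace ℝ V]
    [FiniteDimensional ℝ V] (L : V →ₗ[ℝ] Matrix (Fin m) (Fin m) ℂ) (i j : Fin m) :
    ContDiff ℝ ∞ fun v => NormedSpace.exp (L v) i j := by
  have h1 : ContDiff ℝ ∞ (NormedSpace.exp : Matrix (Fin m) (Fin m) ℂ → _) :=
    contDiff_iff_contDiffAt.2 fun x =>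
      (NormedSpace.exp_analytic (𝕂 := ℝ) x).contDiffAt
  have h2 : ContDiff ℝ ∞ L := L.toContinuousLinearMap.contDiff
  have h3 : ContDiff ℝ ∞ ((Matrix.entryLinearMap ℝ ℂ i j).toContinuousLinearMap) :=
    ContinuousLinearMap.contDiff _
  exact h3.comp (h1.comp h2)

theorem hasDerivAt_exp_matrix_apply (A : Matrix (Fin m) (Fin m) ℂ) (i j : Fin m) :
    HasDerivAt (fun t : ℝ => NormedSpace.exp (t • A) i j) (A i j) 0 := by
  have h1 := hasDerivAt_exp_smul_const (𝕂 := ℝ) A (0 : ℝ)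
  rw [zero_smul, NormedSpace.exp_zero, one_mul] at h1
  exact ((Matrix.entryLinearMap ℝ ℂ i j).toContinuousLinearMap.hasFDerivAt).comp_hasDerivAt _ h1

end Norm

open Matrix

theorem expSU_add_smul (A : su m) (s t : ℝ) :
    expSU ((s + t) • A) = expSU (s • A) * expSU (t • A) := by
  refine Subtype.ext ?_
  change NormedSpace.exp ((s + t) • (A : Matrix (Fin m) (Fin m) ℂ)) =
    NormedSpace.exp (s • (A : Matrix (Fin m) (Fin m) ℂ))
      * NormedSpace.exp (t • (A : Matrix (Fin m) (Fin m) ℂ))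
  rw [add_smul]
  exact Matrix.exp_add_of_commute _ _ (((Commute.refl _).smul_left s).smul_right t)

theorem expSU_zero : expSU (0 : su m) = 1 := Subtype.ext NormedSpace.exp_zero

theorem mul_expSU {σ : specialUnitaryGroup (Fin m) ℂ} {A B : su m}
    (h : (σ : Matrix (Fin m) (Fin m) ℂ) * A = B * (σ : Matrix (Fin m) (Fin m) ℂ)) (t : ℝ) :
    σ * expSU (t • A) = expSU (t • B) * σ := by
  have hu : IsUnit (σ : Matrix (Fin m) (Fin m) ℂ) :=
    (Matrix.isUnit_iff_isUnit_det _).2 (by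
      rw [(mem_specialUnitaryGroup_iff.1 σ.2).2]; exact isUnit_one)
  have hd := (Matrix.isUnit_iff_isUnit_det _).1 hu
  refine Subtype.ext ?_
  change (σ : Matrix (Fin m) (Fin m) ℂ) * NormedSpace.exp (t • (A : Matrix (Fin m) (Fin m) ℂ)) =
    NormedSpace.exp (t • (B : Matrix (Fin m) (Fin m) ℂ)) * σ
  have e : t • (B : Matrix (Fin m) (Fin m) ℂ) =
      (σ : Matrix (Fin m) (Fin m) ℂ) * (t • (A : Matrix (Fin m) (Fin m) ℂ))
        * (σ : Matrix (Fin m) (Fin m) ℂ)⁻¹ := by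
    rw [mul_smul_comm, h, smul_mul_assoc, mul_assoc, mul_nonsing_inv _ hd, mul_one]
  rw [e, Matrix.exp_conj _ _ hu, mul_assoc, nonsing_inv_mul _ hd, mul_one]

end Exponential

/-- The chain rule, at a point whose image is given by an equation. -/
theorem mfderiv_comp_apply_of_base_eq {E₁ E₂ E₃ H₁ H₂ H₃ M₁ M₂ M₃ : Type*}
    [NormedAddCommGroup E₁] [NormedSpace ℝ E₁] [NormedAddCommGroup E₂] [NormedSpace ℝ E₂]
    [NormedAddCommGroup E₃] [NormedSpace ℝ E₃] [TopologicalSpace H₁] [TopologicalSpace H₂]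
    [TopologicalSpace H₃] {I₁ : ModelWithCorners ℝ E₁ H₁} {I₂ : ModelWithCorners ℝ E₂ H₂}
    {I₃ : ModelWithCorners ℝ E₃ H₃} [TopologicalSpace M₁] [ChartedSpace H₁ M₁]
    [TopologicalSpace M₂] [ChartedSpace H₂ M₂] [TopologicalSpace M₃] [ChartedSpace H₃ M₃]
    {g : M₂ → M₃} {f : M₁ → M₂} {x : M₁} {y : M₂} (hy : f x = y)
    (hg : MDifferentiableAt I₂ I₃ g y) (hf : MDifferentiableAt I₁ I₂ f x) (v : E₁) :
    (mfderiv I₁ I₃ (g ∘ f) x v : E₃) =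
      mfderiv I₂ I₃ g y (show TangentSpace I₂ y from (mfderiv I₁ I₂ f x v : E₂)) := by
  subst hy
  exact mfderiv_comp_apply x hg hf v

section Orbit

open Matrix

variable {E : Type*} [NormedAddCommGroup E] [NormedSpace ℝ E] [FiniteDimensional ℝ E]
  {H : Type*} [TopologicalSpace H] {I : ModelWithCorners ℝ E H}
  {M : Type*} [TopologicalSpace M] [ChartedSpace H M] [IsManifold I ∞ M]
  [RiemannianBundle (fun x : M => TangentSpace I x)]
  {n : ℕ} [MulAction (specialUnitaryGroup (Fin (n + 2)) ℂ) M]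
  {ξ : Fin 3 → Π x : M, TangentSpace I x} {o : M}

namespace IsSUHomogeneous

variable (h : IsSUHomogeneous I n ξ o)
include h

theorem contMDiff_actBy (σ : specialUnitaryGroup (Fin (n + 2)) ℂ) :
    CMDiff ∞ (actBy σ : M → M) := by
  have h1 := h.smooth 0 (fun _ => σ) fun i j => contDiff_const
  have h2 : ContMDiff I (𝓘(ℝ, EuclideanSpace ℝ (Fin 0)).prod I) ∞
      fun p : M => ((0 : EuclideanSpace ℝ (Fin 0)), p) :=
    contMDiff_const.prodMk contMDiff_id
  exact h1.comp h2

theorem isSmoothIsometry_actBy (σ : specialUnitaryGroup (Fin (n + 2)) ℂ) :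
    IsSmoothIsometry I (actBy σ : M → M) :=
  ⟨h.contMDiff_actBy σ, h.isometric σ⟩

theorem contMDiff_orbit (p : M) {k : ℕ} (L : EuclideanSpace ℝ (Fin k) →ₗ[ℝ] su (n + 2)) :
    ContMDiff 𝓘(ℝ, EuclideanSpace ℝ (Fin k)) I ∞ fun w => actBy (expSU (L w)) p := by
  have h1 := h.smooth k (fun w => expSU (L w)) fun i j =>
    contDiff_exp_matrix_apply ((su (n + 2)).subtype ∘ₗ L) i j
  have h2 : ContMDiff 𝓘(ℝ, EuclideanSpace ℝ (Fin k)) (𝓘(ℝ, EuclideanSpace ℝ (Fin k)).prod I) ∞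
      fun w : EuclideanSpace ℝ (Fin k) => (w, p) :=
    contMDiff_id.prodMk contMDiff_const
  exact h1.comp h2

theorem exists_fundamentalVec_linear (p : M) :
    ∃ F : su (n + 2) →ₗ[ℝ] TangentSpace I p, ∀ X : su (n + 2), F X = fundamentalVec I X p := by
  set k := Module.finrank ℝ (su (n + 2))
  have e : EuclideanSpace ℝ (Fin k) ≃ₗ[ℝ] su (n + 2) :=
    LinearEquiv.ofFinrankEq _ _ (by simp [k])
  have hγ := (h.contMDiff_orbit p (e : EuclideanSpace ℝ (Fin k) →ₗ[ℝ] su (n + 2)))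
  set γ : EuclideanSpace ℝ (Fin k) → M := fun w => actBy (expSU (e w)) p
  let D : EuclideanSpace ℝ (Fin k) →L[ℝ] TangentSpace I p :=
    show EuclideanSpace ℝ (Fin k) →L[ℝ] E from mfderiv 𝓘(ℝ, EuclideanSpace ℝ (Fin k)) I γ 0
  refine ⟨(D : EuclideanSpace ℝ (Fin k) →ₗ[ℝ] TangentSpace I p) ∘ₗ (e.symm : su (n + 2) →ₗ[ℝ] EuclideanSpace ℝ (Fin k)), fun X => ?_⟩
  have hc : (fun t : ℝ => actBy (expSU (t • X)) p) = γ ∘ fun t : ℝ => t • e.symm X := by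
    funext t
    simp [γ]
  have hl : HasFDerivAt (fun t : ℝ => t • e.symm X)
      ((1 : ℝ →L[ℝ] ℝ).smulRight (e.symm X)) 0 :=
    ((1 : ℝ →L[ℝ] ℝ).smulRight (e.symm X)).hasFDerivAt
  have e2 : mfderiv 𝓘(ℝ, ℝ) 𝓘(ℝ, EuclideanSpace ℝ (Fin k)) (fun t : ℝ => t • e.symm X) 0 (1 : ℝ)
      = e.symm X := by
    rw [hl.hasMFDerivAt.mfderiv]
    exact one_smul ℝ (e.symm X)
  have e3 := mfderiv_comp_apply_of_base_eq (I₃ := I) (g := γ) (y := 0)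
    (f := fun t : ℝ => t • e.symm X) (x := 0) (zero_smul ℝ (e.symm X))
    ((hγ 0).mdifferentiableAt (by simp)) hl.hasMFDerivAt.mdifferentiableAt (1 : ℝ)
  rw [e2] at e3
  rw [fundamentalVec, hc]
  exact e3.symm

theorem mdifferentiable_curve (p : M) (X : su (n + 2)) :
    MDifferentiable 𝓘(ℝ, ℝ) I fun t : ℝ => actBy (expSU (t • X)) p := by
  have h1 := (h.contMDiff_orbit p
    ((LinearMap.toSpanSingleton ℝ _ X) ∘ₗ (EuclideanSpace.proj (𝕜 := ℝ) (0 : Fin 1)).toLinearMap))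
  have h2 : ContMDiff 𝓘(ℝ, ℝ) 𝓘(ℝ, EuclideanSpace ℝ (Fin 1)) ∞
      fun t : ℝ => t • EuclideanSpace.single (0 : Fin 1) (1 : ℝ) :=
    (contDiff_id.smul contDiff_const).contMDiff
  have h3 := (h1.comp h2).mdifferentiable (by simp)
  convert h3 using 2 with t
  simp

theorem map_fundamentalVec {σ : specialUnitaryGroup (Fin (n + 2)) ℂ} (p : M)
    {X Y : su (n + 2)}
    (hXY : (σ : Matrix (Fin (n + 2)) (Fin (n + 2)) ℂ) * X
      = Y * (σ : Matrix (Fin (n + 2)) (Fin (n + 2)) ℂ)) :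
    (mfderiv I I (actBy σ) p (fundamentalVec I X p) : E) = fundamentalVec I Y (actBy σ p) := by
  have hc : (fun t : ℝ => actBy (expSU (t • Y)) (actBy σ p)) =
      (actBy σ) ∘ fun t : ℝ => actBy (expSU (t • X)) p := by
    funext t
    change expSU (t • Y) • σ • p = σ • expSU (t • X) • p
    rw [smul_smul, smul_smul, mul_expSU hXY]
  have h0 : actBy (expSU ((0 : ℝ) • X)) p = p := by
    rw [zero_smul, expSU_zero]; exact one_smul _ p
  rw [fundamentalVec, fundamentalVec, hc]
  exact (mfderiv_comp_apply_of_base_eq (x := (0 : ℝ))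
    (f := fun t : ℝ => actBy (expSU (t • X)) p) h0
    ((h.contMDiff_actBy σ p).mdifferentiableAt (by simp)) (h.mdifferentiable_curve p X 0)
    (1 : ℝ)).symm

theorem orbit_eq_of_fundamentalVec_eq_zero [T2Space M] [BoundarylessManifold I M] (p : M)
    {X : su (n + 2)} (hX : fundamentalVec I X p = 0) (t : ℝ) : actBy (expSU (t • X)) p = p := by
  set c : ℝ → M := fun t => actBy (expSU (t • X)) p with hc
  have hc0 : c 0 = p := by
    rw [hc]
    change actBy (expSU ((0 : ℝ) • X)) p = p
    rw [zero_smul, expSU_zero]; exact one_smul _ p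
  have hd0 : mfderiv 𝓘(ℝ, ℝ) I c 0 = 0 := by
    refine ContinuousLinearMap.ext_ring ?_
    exact hX
  have hd : ∀ s, mfderiv 𝓘(ℝ, ℝ) I c s = 0 := by
    intro s
    have e : c = (actBy (expSU (s • X)) ∘ c) ∘ fun t => t - s := by
      funext t
      change expSU (t • X) • p = expSU (s • X) • expSU ((t - s) • X) • p
      rw [smul_smul, ← expSU_add_smul, add_sub_cancel]
    have hm := (h.contMDiff_actBy (expSU (s • X)) (c 0)).mdifferentiableAt (by simp)
    have hcd := h.mdifferentiable_curve p X 0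
    have h1 : mfderiv 𝓘(ℝ, ℝ) I (actBy (expSU (s • X)) ∘ c) (s - s) = 0 := by
      rw [sub_self, mfderiv_comp 0 hm hcd, hd0]
      exact ContinuousLinearMap.comp_zero _
    have hs : MDifferentiableAt 𝓘(ℝ, ℝ) 𝓘(ℝ, ℝ) (fun t : ℝ => t - s) s :=
      ((hasDerivAt_id s).sub_const s).differentiableAt.mdifferentiableAt
    rw [e, mfderiv_comp_of_eq (y := (0 : ℝ)) (hm.comp 0 hcd) hs (sub_self s), h1]
    exact ContinuousLinearMap.zero_comp _
  have hint : IsMIntegralCurve (I := I) c (fun x => (0 : TangentSpace I x)) := by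
    intro s
    have := (h.mdifferentiable_curve p X s).hasMFDerivAt
    rw [← hc, hd s] at this
    rwa [ContinuousLinearMap.smulRight_zero]
  have hconst : IsMIntegralCurve (I := I) (fun _ : ℝ => p) (fun x => (0 : TangentSpace I x)) := by
    intro s
    rw [ContinuousLinearMap.smulRight_zero]
    exact hasMFDerivAt_const p s
  have : IsManifold I 1 M := .of_le (n := ∞) (WithTop.coe_le_coe.2 le_top)
  have : CompleteSpace E := FiniteDimensional.complete ℝ E
  have := isMIntegralCurve_Ioo_eq_of_contMDiff_boundaryless (t₀ := 0)
    (contMDiff_zeroSection ℝ (TangentSpace I : M → Type _)) hint hconst hc0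
  exact congrFun this t

theorem isotropy_of_fundamentalVec_eq_zero [T2Space M] [BoundarylessManifold I M]
    {X : su (n + 2)} (hX : fundamentalVec I X o = 0) :
    IsIsotropyMatrix n (X : Matrix (Fin (n + 2)) (Fin (n + 2)) ℂ) := by
  have h1 : ∀ t : ℝ, IsIsotropyMatrix n
      (NormedSpace.exp (t • (X : Matrix (Fin (n + 2)) (Fin (n + 2)) ℂ))) := fun t =>
    (h.stabilizer _).1 (h.orbit_eq_of_fundamentalVec_eq_zero o hX t)
  have hz : ∀ i j, (∀ t : ℝ, NormedSpace.exp
      (t • (X : Matrix (Fin (n + 2)) (Fin (n + 2)) ℂ)) i j = 0) →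
      (X : Matrix (Fin (n + 2)) (Fin (n + 2)) ℂ) i j = 0 := fun i j hij => by
    have := hasDerivAt_exp_matrix_apply (X : Matrix (Fin (n + 2)) (Fin (n + 2)) ℂ) i j
    simp only [hij] at this
    exact this.unique (hasDerivAt_const _ _)
  refine ⟨?_, fun j hj => ⟨hz _ _ fun t => ((h1 t).2.1 j hj).1, hz _ _ fun t => ((h1 t).2.1 j hj).2⟩,
    fun j hj => ⟨hz _ _ fun t => ((h1 t).2.2 j hj).1, hz _ _ fun t => ((h1 t).2.2 j hj).2⟩⟩
  have := hasDerivAt_exp_matrix_apply (X : Matrix (Fin (n + 2)) (Fin (n + 2)) ℂ) 0 0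
  simp only [(h1 _).1] at this
  exact this.unique (hasDerivAt_exp_matrix_apply _ _ _)

end IsSUHomogeneous

end Orbit

section LinearAlgebra

variable {V W₁ W₂ : Type*} [NormedAddCommGroup V] [InnerProductSpace ℝ V]
  [AddCommGroup W₁] [Module ℝ W₁] [AddCommGroup W₂] [Module ℝ W₂]

/-- If `J` is an isometry that is the identity on a `3`-dimensional space and squares to `-1` on
a complement, then the orthonormal vectors `ξ r` fixed by `J` determine the orthogonal
decomposition into these two spaces. -/
theorem eq_sum_inner_of_rotation [FiniteDimensional ℝ W₁] (hW : Module.finrank ℝ W₁ = 3)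
    {F₁ : W₁ →ₗ[ℝ] V} {F₂ : W₂ →ₗ[ℝ] V} (hF : ∀ u, ∃ w₁ w₂, F₁ w₁ + F₂ w₂ = u)
    {J : V →ₗ[ℝ] V} (hJ : ∀ u v, ⟪J u, J v⟫_ℝ = ⟪u, v⟫_ℝ) (hJ₁ : ∀ w, J (F₁ w) = F₁ w)
    (hJ₂ : ∀ w, J (J (F₂ w)) = -F₂ w) {ξ : Fin 3 → V} (hξ : Orthonormal ℝ ξ)
    (hJξ : ∀ r, J (ξ r) = ξ r) (w₁ : W₁) (w₂ : W₂) :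
    ∑ s, ⟪ξ s, F₁ w₁ + F₂ w₂⟫_ℝ • ξ s = F₁ w₁ := by
  have hmem : ∀ r, ξ r ∈ LinearMap.range F₁ := by
    intro r
    obtain ⟨a, b, hab⟩ := hF (ξ r)
    have h1 := hJξ r
    rw [← hab, map_add, hJ₁, add_right_inj] at h1
    have h2 := hJ₂ b
    rw [h1, h1, eq_neg_iff_add_eq_zero, ← two_smul ℝ] at h2
    rw [(smul_eq_zero.1 h2).resolve_left two_ne_zero, add_zero] at hab
    exact ⟨a, hab⟩
  have hspan : Submodule.span ℝ (Set.range ξ) = LinearMap.range F₁ := by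
    refine Submodule.eq_of_le_of_finrank_le (Submodule.span_le.2 ?_) ?_
    · rintro _ ⟨r, rfl⟩
      exact hmem r
    · rw [finrank_span_eq_card hξ.linearIndependent, Fintype.card_fin, ← hW]
      exact LinearMap.finrank_range_le F₁
  have horth : ∀ s, ⟪ξ s, F₂ w₂⟫_ℝ = 0 := by
    intro s
    have h1 := hJ (ξ s) (F₂ w₂)
    have h2 := hJ (ξ s) (J (F₂ w₂))
    rw [hJξ, hJ₂, inner_neg_right] at h2
    rw [hJξ] at h1
    linarith
  obtain ⟨c, hc⟩ := (Submodule.mem_span_range_iff_exists_fun ℝ).1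
    (hspan ▸ LinearMap.mem_range_self F₁ w₁ : F₁ w₁ ∈ Submodule.span ℝ (Set.range ξ))
  rw [← hc]
  refine Finset.sum_congr rfl fun s _ => ?_
  rw [inner_add_right, horth, add_zero, hξ.inner_right_fintype]

end LinearAlgebra

section Matrices

open Matrix ComplexConjugate

variable {n : ℕ}

/-- The row `(0, a, 0)`. -/
def middleRow (a : Fin n → ℂ) : Fin (n + 2) → ℂ :=
  Fin.cons 0 (Fin.snoc (α := fun _ => ℂ) a 0)

/-- The index in the middle block. -/
def middle (k : Fin n) : Fin (n + 2) := k.castSucc.succ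

theorem index_cases (i : Fin (n + 2)) :
    i = 0 ∨ i = Fin.last (n + 1) ∨ ∃ k : Fin n, i = middle k := by
  induction i using Fin.cases with
  | zero => exact Or.inl rfl
  | succ i =>
    induction i using Fin.lastCases with
    | last => exact Or.inr (Or.inl rfl)
    | cast k => exact Or.inr (Or.inr ⟨k, rfl⟩)

@[simp] theorem middle_ne_zero (k : Fin n) : middle k ≠ 0 := Fin.succ_ne_zero _

@[simp] theorem middle_ne_last (k : Fin n) : middle k ≠ Fin.last (n + 1) := by
  simp [middle, Fin.ext_iff, k.2.ne]

@[simp] theorem middleRow_zero (a : Fin n → ℂ) : middleRow a 0 = 0 := rfl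

@[simp] theorem middleRow_last (a : Fin n → ℂ) : middleRow a (Fin.last (n + 1)) = 0 := by
  rw [middleRow, ← Fin.succ_last, Fin.cons_succ, Fin.snoc_last]

@[simp] theorem middleRow_middle (a : Fin n → ℂ) (k : Fin n) : middleRow a (middle k) = a k := by
  rw [middleRow, middle, Fin.cons_succ, Fin.snoc_castSucc]

/-- The skew-Hermitian matrix `Y - Yᴴ`, where `Y` has first row `p`, last row `q`, and zeros
elsewhere. -/
def skewOfRows (p q : Fin (n + 2) → ℂ) : Matrix (Fin (n + 2)) (Fin (n + 2)) ℂ :=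
  let Y : Matrix (Fin (n + 2)) (Fin (n + 2)) ℂ := .of fun i j =>
    if i = 0 then p j else if i = Fin.last (n + 1) then q j else 0
  Y - Yᴴ

theorem skewOfRows_apply (p q : Fin (n + 2) → ℂ) (i j : Fin (n + 2)) :
    skewOfRows p q i j = (if i = 0 then p j else if i = Fin.last (n + 1) then q j else 0)
      - conj (if j = 0 then p i else if j = Fin.last (n + 1) then q i else 0) := rfl

theorem sum_index {A : Type*} [AddCommMonoid A] (f : Fin (n + 2) → A) :
    ∑ i, f i = f 0 + (∑ k : Fin n, f (middle k) + f (Fin.last (n + 1))) := by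
  rw [Fin.sum_univ_succ, Fin.sum_univ_castSucc]
  rfl

theorem skewOfRows_mem (p q : Fin (n + 2) → ℂ)
    (h : (p 0).im + (q (Fin.last (n + 1))).im = 0) : skewOfRows p q ∈ su (n + 2) := by
  refine ⟨?_, ?_⟩
  · simp [skewOfRows]
  · rw [Matrix.trace, sum_index]
    simp only [diag_apply, skewOfRows_apply]
    apply Complex.ext
    · simp
    · simp
      linarith

/-- The matrix with first row `(0, a, 0)` and last row `(0, b, 0)`. -/
def offBlock (n : ℕ) : ((Fin n → ℂ) × (Fin n → ℂ)) →ₗ[ℝ] su (n + 2) where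
  toFun w := ⟨skewOfRows (middleRow w.1) (middleRow w.2), skewOfRows_mem _ _ (by simp)⟩
  map_add' w w' := by
    refine Subtype.ext (Matrix.ext fun i j => ?_)
    change skewOfRows _ _ i j = skewOfRows _ _ i j + skewOfRows _ _ i j
    rcases index_cases i with rfl | rfl | ⟨i, rfl⟩ <;>
      rcases index_cases j with rfl | rfl | ⟨j, rfl⟩ <;> simp [skewOfRows_apply] <;> ring
  map_smul' c w := by
    refine Subtype.ext (Matrix.ext fun i j => ?_)
    change skewOfRows _ _ i j = c • skewOfRows _ _ i j
    rcases index_cases i with rfl | rfl | ⟨i, rfl⟩ <;>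
      rcases index_cases j with rfl | rfl | ⟨j, rfl⟩ <;> simp [skewOfRows_apply]

/-- The matrix with corner entries `i x`, `z`, `-z̄`, `-i x`. -/
def cornerBlock (n : ℕ) : (ℝ × ℂ) →ₗ[ℝ] su (n + 2) where
  toFun w := ⟨skewOfRows (fun j => if j = 0 then (w.1 / 2 : ℝ) * Complex.I
      else if j = Fin.last (n + 1) then w.2 else 0)
    (fun j => if j = Fin.last (n + 1) then -((w.1 / 2 : ℝ) * Complex.I) else 0),
    skewOfRows_mem _ _ (by simp)⟩
  map_add' w w' := by
    refine Subtype.ext (Matrix.ext fun i j => ?_)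
    change skewOfRows _ _ i j = skewOfRows _ _ i j + skewOfRows _ _ i j
    rcases index_cases i with rfl | rfl | ⟨i, rfl⟩ <;>
      rcases index_cases j with rfl | rfl | ⟨j, rfl⟩ <;> simp [skewOfRows_apply] <;> ring
  map_smul' c w := by
    refine Subtype.ext (Matrix.ext fun i j => ?_)
    change skewOfRows _ _ i j = c • skewOfRows _ _ i j
    rcases index_cases i with rfl | rfl | ⟨i, rfl⟩ <;>
      rcases index_cases j with rfl | rfl | ⟨j, rfl⟩ <;> simp [skewOfRows_apply] <;> ring

theorem offBlock_apply (w : (Fin n → ℂ) × (Fin n → ℂ)) (i j : Fin (n + 2)) :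
    (offBlock n w : Matrix _ _ ℂ) i j = skewOfRows (middleRow w.1) (middleRow w.2) i j := rfl

theorem cornerBlock_apply (w : ℝ × ℂ) (i j : Fin (n + 2)) :
    (cornerBlock n w : Matrix _ _ ℂ) i j =
      skewOfRows (fun j => if j = 0 then (w.1 / 2 : ℝ) * Complex.I
        else if j = Fin.last (n + 1) then w.2 else 0)
      (fun j => if j = Fin.last (n + 1) then -((w.1 / 2 : ℝ) * Complex.I) else 0) i j := rfl

theorem eq_zero_of_isIsotropyMatrix {w₁ : ℝ × ℂ} {w₂ : (Fin n → ℂ) × (Fin n → ℂ)}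
    (h : IsIsotropyMatrix n ((cornerBlock n w₁ + offBlock n w₂ : su (n + 2)) :
      Matrix (Fin (n + 2)) (Fin (n + 2)) ℂ)) : w₁ = 0 ∧ w₂ = 0 := by
  obtain ⟨h0, h1, h2⟩ := h
  have ha : ∀ i j, ((cornerBlock n w₁ + offBlock n w₂ : su (n + 2)) :
      Matrix (Fin (n + 2)) (Fin (n + 2)) ℂ) i j = (cornerBlock n w₁ : Matrix _ _ ℂ) i j
        + (offBlock n w₂ : Matrix _ _ ℂ) i j := fun _ _ => rfl
  simp only [ha, cornerBlock_apply, offBlock_apply] at h0 h1 h2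
  refine ⟨Prod.ext ?_ ?_, Prod.ext (funext fun k => ?_) (funext fun k => ?_)⟩
  · have := congrArg Complex.im h0
    simp [skewOfRows_apply, -Complex.ofReal_div] at this
    simp
    linarith
  · have := (h1 (Fin.last (n + 1)) (by simp)).1
    simpa [skewOfRows_apply] using this
  · have := (h1 (middle k) (by simp)).1
    simpa [skewOfRows_apply] using this
  · have := (h2 (middle k) (by simp)).1
    simpa [skewOfRows_apply] using this

theorem hEntry_zero : hEntry n 0 = (1 + (n : ℂ) / 2)⁻¹ * -((n : ℂ) / 2 * Complex.I) := by
  simp [hEntry]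

theorem hEntry_last : hEntry n (Fin.last (n + 1)) = hEntry n 0 := by
  simp [hEntry]

theorem hEntry_middle (k : Fin n) : hEntry n (middle k) = hEntry n 0 + Complex.I := by
  have : (2 + (n : ℂ)) ≠ 0 := by
    exact_mod_cast (by positivity : 2 + n ≠ 0)
  have : (1 + (n : ℂ) / 2) ≠ 0 := by
    rw [show 1 + (n : ℂ) / 2 = (2 + n) / 2 by ring]
    exact div_ne_zero this two_ne_zero
  rw [hEntry_zero, hEntry]
  simp only [middle_ne_zero, middle_ne_last, or_self, if_false]
  field_simp
  ring

theorem suBracket_hElt_cornerBlock (w : ℝ × ℂ) : suBracket (hElt n) (cornerBlock n w) = 0 := by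
  refine Subtype.ext (Matrix.ext fun i j => ?_)
  change (diagonal (hEntry n) * (cornerBlock n w).1 - (cornerBlock n w).1 * diagonal (hEntry n) :
    Matrix (Fin (n + 2)) (Fin (n + 2)) ℂ) i j = 0
  rw [Matrix.sub_apply, diagonal_mul, mul_diagonal, cornerBlock_apply]
  rcases index_cases i with rfl | rfl | ⟨i, rfl⟩ <;>
      rcases index_cases j with rfl | rfl | ⟨j, rfl⟩ <;>
    simp [skewOfRows_apply, hEntry_last] <;> ring

theorem suBracket_hElt_offBlock (w : (Fin n → ℂ) × (Fin n → ℂ)) :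
    suBracket (hElt n) (offBlock n w) = offBlock n (-Complex.I • w) := by
  refine Subtype.ext (Matrix.ext fun i j => ?_)
  change (diagonal (hEntry n) * (offBlock n w).1 - (offBlock n w).1 * diagonal (hEntry n) :
    Matrix (Fin (n + 2)) (Fin (n + 2)) ℂ) i j = _
  rw [Matrix.sub_apply, diagonal_mul, mul_diagonal, offBlock_apply, offBlock_apply]
  rcases index_cases i with rfl | rfl | ⟨i, rfl⟩ <;>
      rcases index_cases j with rfl | rfl | ⟨j, rfl⟩ <;>
    simp [skewOfRows_apply, hEntry_last, hEntry_middle] <;> ring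

/-- The element `exp(π h / 2)`. -/
def rotationElt (n : ℕ) : specialUnitaryGroup (Fin (n + 2)) ℂ := expSU ((Real.pi / 2) • hElt n)

theorem rotationElt_coe : (rotationElt n : Matrix (Fin (n + 2)) (Fin (n + 2)) ℂ) =
    diagonal fun i => Complex.exp ((Real.pi / 2 : ℝ) * hEntry n i) := by
  change NormedSpace.exp ((Real.pi / 2) • diagonal (hEntry n)) = _
  rw [← diagonal_smul, exp_diagonal]
  congr 1
  ext i
  simp [Pi.coe_exp, ← Complex.exp_eq_exp_ℂ]

theorem exp_hEntry_middle (k : Fin n) : Complex.exp ((Real.pi / 2 : ℝ) * hEntry n (middle k)) =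
    Complex.I * Complex.exp ((Real.pi / 2 : ℝ) * hEntry n 0) := by
  rw [hEntry_middle, mul_add, Complex.exp_add, mul_comm]
  congr 1
  push_cast
  exact Complex.exp_pi_div_two_mul_I

theorem isIsotropyMatrix_rotationElt :
    IsIsotropyMatrix n (rotationElt n : Matrix (Fin (n + 2)) (Fin (n + 2)) ℂ) := by
  rw [rotationElt_coe]
  refine ⟨by simp [hEntry_last], fun j hj => ?_, fun j hj => ?_⟩
  · simp [hj, hj.symm]
  · simp [hj, hj.symm]

theorem rotationElt_mul_cornerBlock (w : ℝ × ℂ) :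
    (rotationElt n : Matrix (Fin (n + 2)) (Fin (n + 2)) ℂ) * cornerBlock n w
      = cornerBlock n w * (rotationElt n : Matrix (Fin (n + 2)) (Fin (n + 2)) ℂ) := by
  ext i j
  rw [rotationElt_coe, diagonal_mul, mul_diagonal, cornerBlock_apply]
  rcases index_cases i with rfl | rfl | ⟨i, rfl⟩ <;>
      rcases index_cases j with rfl | rfl | ⟨j, rfl⟩ <;>
    simp [skewOfRows_apply, hEntry_last] <;> ring

theorem rotationElt_mul_offBlock (w : (Fin n → ℂ) × (Fin n → ℂ)) :
    (rotationElt n : Matrix (Fin (n + 2)) (Fin (n + 2)) ℂ) * offBlock n w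
      = offBlock n (-Complex.I • w) * (rotationElt n : Matrix (Fin (n + 2)) (Fin (n + 2)) ℂ) := by
  ext i j
  rw [rotationElt_coe, diagonal_mul, mul_diagonal, offBlock_apply, offBlock_apply]
  rcases index_cases i with rfl | rfl | ⟨i, rfl⟩ <;>
      rcases index_cases j with rfl | rfl | ⟨j, rfl⟩ <;>
    simp [skewOfRows_apply, hEntry_last, exp_hEntry_middle, -Complex.ofReal_div] <;>
    ring_nf <;> simp

end Matrices

section Homogeneous

open Matrix

variable {E : Type*} [NormedAddCommGroup E] [NormedSpace ℝ E] [FiniteDimensional ℝ E]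
  {H : Type*} [TopologicalSpace H] {I : ModelWithCorners ℝ E H}
  {M : Type*} [TopologicalSpace M] [ChartedSpace H M] [IsManifold I ∞ M]
  [RiemannianBundle (fun x : M => TangentSpace I x)]
  {n : ℕ} [MulAction (specialUnitaryGroup (Fin (n + 2)) ℂ) M]
  {ξ : Fin 3 → Π x : M, TangentSpace I x} {o : M}
  {φ₀ : Π x : M, TangentSpace I x →L[ℝ] TangentSpace I x}

theorem IsPhiZero.preservesSmooth (h : IsPhiZero I n o φ₀) : PreservesSmooth φ₀ :=
  fun _ p hX => (h.smooth p).clm_bundle_apply hX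

theorem IsPhiZero.preservesMDiff (h : IsPhiZero I n o φ₀) : PreservesMDiff φ₀ :=
  fun _ p hX => ((h.smooth p).mdifferentiableAt (by simp)).clm_bundle_apply hX

namespace IsSUHomogeneous

variable (h : IsSUHomogeneous I n ξ o)
include h

theorem actBy_rotationElt : actBy (rotationElt n) o = o :=
  (h.stabilizer _).2 isIsotropyMatrix_rotationElt

variable [T2Space M] [BoundarylessManifold I M]

/-- At the base point, the derivative of the transformation `exp(π h / 2)` is
`φ₀ + ∑ₛ ηₛ ⊗ ξₛ`, and `φ₀² = -1 + ∑ₛ ηₛ ⊗ ξₛ`. -/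
theorem rotation_basePoint (hE : Module.finrank ℝ E = 4 * n + 3) (hφ : IsPhiZero I n o φ₀)
    (ho : ∀ x, Orthonormal ℝ fun r => ξ r x) (u : TangentSpace I o) :
    (mfderiv I I (actBy (rotationElt n)) o u : E) = tangentRotation ξ φ₀ o u ∧
      φ₀ o (φ₀ o u) = -u + ∑ s, ⟪ξ s o, u⟫_ℝ • ξ s o := by
  obtain ⟨F, hF⟩ := h.exists_fundamentalVec_linear o
  set F₁ : ℝ × ℂ →ₗ[ℝ] TangentSpace I o := F ∘ₗ cornerBlock n with hF₁
  set F₂ : (Fin n → ℂ) × (Fin n → ℂ) →ₗ[ℝ] TangentSpace I o := F ∘ₗ offBlock n with hF₂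
  have hinj : Function.Injective (F₁.coprod F₂) := by
    refine (injective_iff_map_eq_zero _).2 fun w hw => ?_
    rw [LinearMap.coprod_apply, hF₁, hF₂, LinearMap.comp_apply, LinearMap.comp_apply, ← map_add,
      hF] at hw
    exact Prod.ext_iff.2 (eq_zero_of_isIsotropyMatrix (h.isotropy_of_fundamentalVec_eq_zero hw))
  have hdim : Module.finrank ℝ ((ℝ × ℂ) × ((Fin n → ℂ) × (Fin n → ℂ)))
      = Module.finrank ℝ (TangentSpace I o) := by
    rw [show Module.finrank ℝ (TangentSpace I o) = _ from hE]
    simp [Module.finrank_pi_fintype]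
    ring
  have hsurj : ∀ u, ∃ w₁ w₂, F₁ w₁ + F₂ w₂ = u := fun u => by
    obtain ⟨w, hw⟩ := (LinearMap.injective_iff_surjective_of_finrank_eq_finrank hdim).1 hinj u
    exact ⟨w.1, w.2, hw⟩
  let J : TangentSpace I o →ₗ[ℝ] TangentSpace I o :=
    ((show E →L[ℝ] E from mfderiv I I (actBy (rotationElt n)) o) : E →ₗ[ℝ] E)
  have hτ := h.actBy_rotationElt
  have hJ : ∀ u v, ⟪J u, J v⟫_ℝ = ⟪u, v⟫_ℝ := by
    have key : ∀ q, actBy (rotationElt n) o = q → ∀ u v : TangentSpace I o,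
        ⟪(show TangentSpace I q from mfderiv I I (actBy (rotationElt n)) o u),
          (show TangentSpace I q from mfderiv I I (actBy (rotationElt n)) o v)⟫_ℝ
          = ⟪u, v⟫_ℝ := by
      rintro _ rfl u v
      exact h.isometric _ _ _ _
    exact key o hτ
  have hJF : ∀ {X Y : su (n + 2)}, (rotationElt n : Matrix (Fin (n + 2)) (Fin (n + 2)) ℂ) * X
      = Y * (rotationElt n : Matrix (Fin (n + 2)) (Fin (n + 2)) ℂ) → J (F X) = F Y := by
    intro X Y hXY
    have key : ∀ q, actBy (rotationElt n) o = q →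
        (mfderiv I I (actBy (rotationElt n)) o (fundamentalVec I X o) : E)
          = fundamentalVec I Y q := by
      rintro _ rfl
      exact h.map_fundamentalVec o hXY
    rw [hF, hF]
    exact key o hτ
  have hJ₁ : ∀ w, J (F₁ w) = F₁ w := fun w => hJF (rotationElt_mul_cornerBlock w)
  have hJ₂ : ∀ w, J (F₂ w) = F₂ (-Complex.I • w) := fun w => hJF (rotationElt_mul_offBlock w)
  have hI : ∀ w : (Fin n → ℂ) × (Fin n → ℂ), -Complex.I • -Complex.I • w = -w := fun w => by
    rw [smul_smul]
    simp
  have hJJ₂ : ∀ w, J (J (F₂ w)) = -F₂ w := fun w => by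
    rw [hJ₂, hJ₂, hI, map_neg]
  have hJξ : ∀ r, J (ξ r o) = ξ r o := by
    intro r
    have key : ∀ q, actBy (rotationElt n) o = q →
        (mfderiv I I (actBy (rotationElt n)) o (ξ r o) : E) = ξ r q := by
      rintro _ rfl
      exact h.map_reeb _ r o
    exact key o hτ
  have hφ₁ : ∀ w, φ₀ o (F₁ w) = 0 := fun w => by
    rw [hF₁, LinearMap.comp_apply, hF, hφ.basePoint, suBracket_hElt_cornerBlock, ← hF, map_zero]
  have hφ₂ : ∀ w, φ₀ o (F₂ w) = F₂ (-Complex.I • w) := fun w => by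
    rw [hF₂, LinearMap.comp_apply, hF, hφ.basePoint, suBracket_hElt_offBlock, ← hF]
    rfl
  obtain ⟨w₁, w₂, rfl⟩ := hsurj u
  have hsum := eq_sum_inner_of_rotation (by simp) hsurj hJ hJ₁ hJJ₂ (ho o) hJξ w₁ w₂
  refine ⟨?_, ?_⟩
  · change J (F₁ w₁ + F₂ w₂) = _
    rw [tangentRotation_apply, hsum, map_add, map_add, hJ₁, hJ₂, hφ₁, hφ₂]
    abel
  · rw [hsum, map_add, hφ₁, hφ₂, zero_add, hφ₂, hI, map_neg]
    abel

theorem hasRotations [IsContMDiffRiemannianBundle I ∞ E (fun x : M => TangentSpace I x)]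
    (hE : Module.finrank ℝ E = 4 * n + 3) (hφ : IsPhiZero I n o φ₀)
    (ho : ∀ x, Orthonormal ℝ fun r => ξ r x) : HasRotations ξ φ₀ := by
  have htrans := h.transitive
  have hsurj : ∀ (σ : specialUnitaryGroup (Fin (n + 2)) ℂ) (v : TangentSpace I (actBy σ o)),
      ∃ u : TangentSpace I o, mfderiv I I (actBy σ) o u = v := fun σ v =>
    ((h.isSmoothIsometry_actBy σ).isInvertible o).surjective v
  have hinner : ∀ (σ : specialUnitaryGroup (Fin (n + 2)) ℂ) (s : Fin 3) (u : TangentSpace I o),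
      ⟪ξ s (actBy σ o), mfderiv I I (actBy σ) o u⟫_ℝ = ⟪ξ s o, u⟫_ℝ := fun σ s u => by
    rw [← h.map_reeb, h.isometric]
  have hsum : ∀ (σ : specialUnitaryGroup (Fin (n + 2)) ℂ) (u : TangentSpace I o),
      ∑ s, ⟪ξ s (actBy σ o), mfderiv I I (actBy σ) o u⟫_ℝ • ξ s (actBy σ o)
        = mfderiv I I (actBy σ) o (∑ s, ⟪ξ s o, u⟫_ℝ • ξ s o) := fun σ u => by
    rw [map_sum]
    refine Finset.sum_congr rfl fun s _ => ?_
    rw [map_smul, h.map_reeb, hinner]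
  refine ⟨hφ.preservesSmooth, hφ.preservesMDiff, fun p v => ?_, fun p => ?_⟩
  · obtain ⟨σ, rfl⟩ : ∃ σ : specialUnitaryGroup (Fin (n + 2)) ℂ, actBy σ o = p :=
      MulAction.exists_smul_eq _ o p
    obtain ⟨u, rfl⟩ := hsurj σ v
    rw [hsum, ← hφ.invariant, ← hφ.invariant, (h.rotation_basePoint hE hφ ho u).2, map_add,
      map_neg]
  · obtain ⟨σ, rfl⟩ : ∃ σ : specialUnitaryGroup (Fin (n + 2)) ℂ, actBy σ o = p :=
      MulAction.exists_smul_eq _ o p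
    have hcomm : (actBy (σ * rotationElt n * σ⁻¹) : M → M) ∘ actBy σ
        = actBy σ ∘ actBy (rotationElt n) := by
      funext q
      change (σ * rotationElt n * σ⁻¹) • σ • q = σ • rotationElt n • q
      rw [smul_smul, smul_smul, inv_mul_cancel_right]
    have hd : ∀ τ : specialUnitaryGroup (Fin (n + 2)) ℂ, ∀ q,
        MDifferentiableAt I I (actBy τ : M → M) q := fun τ q =>
      (h.contMDiff_actBy τ q).mdifferentiableAt (by simp)
    refine ⟨actBy (σ * rotationElt n * σ⁻¹), h.isSmoothIsometry_actBy _, ?_,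
      fun r q => h.map_reeb _ r q, fun q u => hφ.invariant _ q u, fun v => ?_⟩
    · have := congrFun hcomm o
      simp only [Function.comp_apply, h.actBy_rotationElt] at this
      exact this
    · obtain ⟨u, rfl⟩ := hsurj σ v
      have e1 := mfderiv_comp_apply_of_base_eq (I₁ := I) (I₂ := I) (I₃ := I)
        (h.actBy_rotationElt) (hd σ o) (hd (rotationElt n) o) u
      have e2 := mfderiv_comp_apply o (hd (σ * rotationElt n * σ⁻¹) (actBy σ o)) (hd σ o) u
      rw [hcomm] at e2
      rw [tangentRotation_apply, hsum, ← hφ.invariant, ← map_add]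
      refine e2.symm.trans (e1.trans ?_)
      rw [(h.rotation_basePoint hE hφ ho u).1, tangentRotation_apply]

end IsSUHomogeneous

end Homogeneous

theorem proposition5p7 (n : ℕ) (hn : 1 ≤ n)
    {M : Type*} [TopologicalSpace M] [T2Space M] [Nonempty M]
    [ChartedSpace (EuclideanSpace ℝ (Fin (4 * n + 3))) M]
    [IsManifold (𝓡 (4 * n + 3)) ∞ M]
    [RiemannianBundle (fun x : M => TangentSpace (𝓡 (4 * n + 3)) x)]
    [IsContMDiffRiemannianBundle (𝓡 (4 * n + 3)) ∞ (EuclideanSpace ℝ (Fin (4 * n + 3)))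
      (fun x : M => TangentSpace (𝓡 (4 * n + 3)) x)]
    (cov : CovariantDerivative (𝓡 (4 * n + 3)) (EuclideanSpace ℝ (Fin (4 * n + 3)))
      (TangentSpace (𝓡 (4 * n + 3)) : M → Type _))
    (hcov : IsLeviCivita cov)
    (ξ : Fin 3 → Π x : M, TangentSpace (𝓡 (4 * n + 3)) x)
    (hξ : IsThreeSasakian cov ξ) :
    HasZeroDivergence cov (torsionO ξ) ∧
    (∀ r, HasZeroDivergence cov (torsionRS cov ξ r r)) ∧
    (∀ (r : Fin 3) (p : M) (u v : TangentSpace (𝓡 (4 * n + 3)) p),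
      divergence cov (torsionRS cov ξ r (r + 1)) p u v =
        2 * PhiOf cov (ξ (r + 2)) p u v
          + (4 * n + 2) * wedge₁₁ (etaOf (ξ r) p) (etaOf (ξ (r + 1)) p) u v) ∧
    (∀ (r : Fin 3) (p : M) (u v : TangentSpace (𝓡 (4 * n + 3)) p),
      divergence cov (torsionRS cov ξ r (r + 2)) p u v =
        -2 * PhiOf cov (ξ (r + 1)) p u v
          + (4 * n + 2) * wedge₁₁ (etaOf (ξ r) p) (etaOf (ξ (r + 2)) p) u v) ∧
    (∀ (a : ℝ) (B : Matrix (Fin 3) (Fin 3) ℝ),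
      (HasZeroDivergence cov (torsionAB cov ξ a B) ↔ B.IsSymm) ∧
      (HasSymmetricRicci (addTensor cov (torsionAB cov ξ a B)) ↔ B.IsSymm) ∧
      (HasSymmetricRicci (addTensor cov fun x => (1 / 2 : ℝ) • torsionAB cov ξ a B x)
        ↔ B.IsSymm)) ∧
    (∀ [MulAction (Matrix.specialUnitaryGroup (Fin (n + 2)) ℂ) M] (o : M)
      (φ₀ : Π x : M, TangentSpace (𝓡 (4 * n + 3)) x →L[ℝ] TangentSpace (𝓡 (4 * n + 3)) x),
      IsSUHomogeneous (𝓡 (4 * n + 3)) n ξ o → IsPhiZero (𝓡 (4 * n + 3)) n o φ₀ →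
        (∀ r, HasZeroDivergence cov (torsionOf (ξ r) φ₀)) ∧
        ∀ (a : ℝ) (B : Matrix (Fin 3) (Fin 3) ℝ) (c : Fin 3 → ℝ),
          (HasZeroDivergence cov (torsionABC cov ξ φ₀ a B c) ↔ B.IsSymm) ∧
          (HasSymmetricRicci (addTensor cov (torsionABC cov ξ φ₀ a B c)) ↔ B.IsSymm) ∧
          (HasSymmetricRicci (addTensor cov fun x => (1 / 2 : ℝ) • torsionABC cov ξ φ₀ a B c x)
            ↔ B.IsSymm)) := by
  have hE : Module.finrank ℝ (EuclideanSpace ℝ (Fin (4 * n + 3))) = 4 * n + 3 := by simp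
  have hE3 : 3 < Module.finrank ℝ (EuclideanSpace ℝ (Fin (4 * n + 3))) := by
    rw [hE]
    omega
  have hcoef : (Module.finrank ℝ (EuclideanSpace ℝ (Fin (4 * n + 3))) : ℝ) - 1 = 4 * n + 2 := by
    rw [hE]
    push_cast
    ring
  refine ⟨hξ.divergence_torsionO hcov, fun r => hξ.divergence_torsionRS_self hcov r,
    fun r p u v => ?_, fun r p u v => ?_, fun a B => ?_, fun o φ₀ hSU hφ => ?_⟩
  · rw [hξ.divergence_torsionRS_next hcov, hcoef]
  · rw [hξ.divergence_torsionRS_prev hcov, hcoef]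
  · have := hξ.torsionAB_add_iff hcov hE3 IsSmoothThreeForm.zero
      (fun p u v => IsSmoothThreeForm.divergence_zero p u v) a B
    simpa only [add_zero] using this
  · have hrot := hSU.hasRotations hE hφ hξ.orthonormal
    have hdiv := fun r => hrot.hasZeroDivergence_torsionOf hξ.orthonormal hcov hξ r
    have hform := fun r => isSmoothThreeForm_torsionOf hrot.preservesSmooth
      (hrot.isSkewField hξ.orthonormal) (hξ.sasakian r).smooth
    refine ⟨hdiv, fun a B c => ?_⟩
    obtain ⟨hS, hS0⟩ := IsSmoothThreeForm.sum (cov := cov) Finset.univ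
      fun r => (hform r).smul (c r)
    refine hξ.torsionAB_add_iff hcov hE3 hS (fun p u v => ?_) a B
    rw [hS0]
    refine Finset.sum_eq_zero fun r _ => ?_
    rw [divergence_smul (c r) ((hform r).mdiffAt u v), hdiv r p u v, mul_zero]
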